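/- Let $M$ be a $C^\infty$ manifold (finite-dimensional, Hausdorff, second countable, without boundary). A $C^0$ vector field on $M$ is \emph{uniquely integrable} if it has a unique maximal integral curve through each point. A compact set $A\subset M$ that is invariant for such a vector field is \emph{asymptotically stable} if for every open set $W\supset A$ there is an open set $V\supset A$ such that all maximal forward integral curves starting in $V$ are defined for all positive time, are contained in $W$, and converge to $A$. Let $X$, $Y$ be uniquely integrable $C^0$ vector fields on $M$, and let $A\subset M$ be a compact set that is asymptotically stable for both. Then for all sufficiently small open sets $U\supset A$ (that is, there is an open set $U_0\supset A$ such that for all open sets $U$ with $A\subset U\subset U_0$) the vector fields $X$ and $Y$ are nowhere zero on $U\setminus A$, and the maps $X|_{U\setminus A}, Y|_{U\setminus A}\colon U\setminus A\to T(U\setminus A)\setminus 0$ into the tangent bundle minus its zero section induce the same graded homomorphism $$(X|_{U\setminus A})_* = (Y|_{U\setminus A})_*\colon H_\bullet(U\setminus A)\to H_\bullet(T(U\setminus A)\setminus 0)$$ on singular homology (with coefficients in any abelian group, in particular $\mathbb{Z}$). -/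

import Mathlib

open Set Filter Topology
open scoped Manifold ContDiff

universe u

noncomputable section

section VectorFields

variable {n : ℕ} {M : Type*} [TopologicalSpace M] [ChartedSpace (EuclideanSpace ℝ (Fin n)) M]
  [IsManifold (𝓡 n) ∞ M]

/-- `X` is a `C^0` vector field on `M`: a continuous section of the tangent bundle. -/
def IsC0VectorField (X : ∀ x : M, TangentSpace (𝓡 n) x) : Prop :=
  Continuous (fun x : M => (⟨x, X x⟩ : TangentBundle (𝓡 n) M))

/-- `γ`, restricted to `J`, is an integral curve of `X` with `γ 0 = x`, defined on the open
interval `J ∋ 0`. The values of `γ` outside `J` are irrelevant. -/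
structure IsIntegralCurveFrom (X : ∀ x : M, TangentSpace (𝓡 n) x) (x : M)
    (J : Set ℝ) (γ : ℝ → M) : Prop where
  isOpen : IsOpen J
  ordConnected : J.OrdConnected
  zero_mem : (0 : ℝ) ∈ J
  initial : γ 0 = x
  integral : IsMIntegralCurveOn γ X J

/-- `γ`, restricted to `J`, is a maximal integral curve of `X` with `γ 0 = x`: it has no extension
to an integral curve on a larger open interval. -/
structure IsMaximalIntegralCurve (X : ∀ x : M, TangentSpace (𝓡 n) x) (x : M)
    (J : Set ℝ) (γ : ℝ → M) : Prop extends IsIntegralCurveFrom X x J γ where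
  maximal : ∀ (J' : Set ℝ) (γ' : ℝ → M), IsIntegralCurveFrom X x J' γ' → J ⊆ J' →
    EqOn γ γ' J → J' = J

/-- `X` has unique maximal integral curves: for every initial point there is one, and any two have
the same domain and agree on it. -/
def UniquelyIntegrable (X : ∀ x : M, TangentSpace (𝓡 n) x) : Prop :=
  ∀ x : M, (∃ (J : Set ℝ) (γ : ℝ → M), IsMaximalIntegralCurve X x J γ) ∧
    ∀ (J₁ J₂ : Set ℝ) (γ₁ γ₂ : ℝ → M), IsMaximalIntegralCurve X x J₁ γ₁ →
      IsMaximalIntegralCurve X x J₂ γ₂ → J₁ = J₂ ∧ EqOn γ₁ γ₂ J₁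

/-- `A` is invariant: maximal integral curves through points of `A` stay in `A`, in forward and
backward time, as long as they are defined. -/
def IsInvariantSet (X : ∀ x : M, TangentSpace (𝓡 n) x) (A : Set M) : Prop :=
  ∀ x ∈ A, ∀ (J : Set ℝ) (γ : ℝ → M), IsMaximalIntegralCurve X x J γ → ∀ t ∈ J, γ t ∈ A

/-- The compact set `A` is asymptotically stable for `X`: it is compact and invariant, and for every
open `W ⊇ A` there is an open `V ⊇ A` such that all maximal forward integral curves starting in `V`
are defined for all positive time, are contained in `W`, and converge to `A` (enter every
neighbourhood of `A` eventually). -/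
structure IsAsymptoticallyStable (X : ∀ x : M, TangentSpace (𝓡 n) x) (A : Set M) : Prop where
  isCompact : IsCompact A
  invariant : IsInvariantSet X A
  attracting : ∀ W : Set M, IsOpen W → A ⊆ W → ∃ V : Set M, IsOpen V ∧ A ⊆ V ∧
    ∀ x ∈ V, ∀ (J : Set ℝ) (γ : ℝ → M), IsMaximalIntegralCurve X x J γ →
      Ici 0 ⊆ J ∧ (∀ t : ℝ, 0 ≤ t → γ t ∈ W) ∧ Tendsto γ atTop (𝓝ˢ A)

variable (n) in
/-- `TS ∖ 0` for `S ⊆ M` open: the nonzero tangent vectors of `M` with base point in `S`. -/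
def nonzeroTangent (S : Set M) : Set (TangentBundle (𝓡 n) M) :=
  {v | v.proj ∈ S ∧ v.snd ≠ 0}

/-- The restriction `X|_S`, viewed as a continuous map `S → TS ∖ 0`, for a `C^0` vector field `X`
that vanishes nowhere on `S`. -/
def restrictNonzero (X : ∀ x : M, TangentSpace (𝓡 n) x) (hX : IsC0VectorField X) (S : Set M)
    (h0 : ∀ x ∈ S, X x ≠ 0) : C(S, nonzeroTangent n S) where
  toFun x := ⟨⟨x.1, X x.1⟩, x.2, h0 x.1 x.2⟩
  continuous_toFun := Continuous.subtype_mk (Continuous.comp hX continuous_subtype_val) _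

end VectorFields

section Homology

open CategoryTheory AlgebraicTopology

/-- The homomorphism `f_* : H_k(S; G) → H_k(T; G)` on singular homology with coefficients in the
abelian group `G`, induced by a continuous map `f`. -/
def singularHomologyMap {S T : Type u} [TopologicalSpace S] [TopologicalSpace T]
    (G : Type u) [AddCommGroup G] (k : ℕ) (f : C(S, T)) :
    ((singularHomologyFunctor AddCommGrpCat.{u} k).obj (AddCommGrpCat.of G)).obj (TopCat.of S) ⟶
      ((singularHomologyFunctor AddCommGrpCat.{u} k).obj (AddCommGrpCat.of G)).obj (TopCat.of T) :=
  ((singularHomologyFunctor AddCommGrpCat.{u} k).obj (AddCommGrpCat.of G)).map (TopCat.ofHom f)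

end Homology

end

/-! Write E = U \ A, D for the basin of A under X with A removed, and Φ, Ψ for the forward flows of
X, Y. Near the diagonal of M there is a continuous family of tangent vectors v x y at x, zero only
for x = y and equal to the coordinate displacement to first order (`exists_displacementVector`).
Since orbits in the basin outside A never return to their starting point, X is homotopic through
nowhere zero fields on E to x ↦ v x (Φ_ε x), and Y to x ↦ v x (Ψ_ε x)
(`restrictNonzero_homotopic_displacement`). So up to homotopy both fields factor, by the same map v,
through the graph maps f x = (x, Φ_ε x) and g x = (x, Ψ_ε x) into O ∩ P, where O is a neighbourhood
of the diagonal in E × D and P is the complement of the diagonal.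

The maps f and g are homotopic in O, because all flow times involved are small. They are also
homotopic in P: follow Φ for a long time, then Ψ for a long time, then shorten the Φ-part to zero
and finally the Ψ-part; attraction to A keeps the endpoint away from x. These two homotopies need
not be compatible, but homology does not notice. Flowing the second factor for a long time deforms E
× D into P, so H_{k+1}(P) → H_{k+1}(E × D) is onto, the Mayer–Vietoris connecting map vanishes, and
H_k(O ∩ P) → H_k(O) ⊕ H_k(P) is injective (`eq_zero_of_cover`, `singularHomologyMap_eq_of_cover`).
Hence f and g agree in homology.

Two foundations are built on the way: the Mayer–Vietoris injectivity, by barycentric subdivision at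
chain level (`exists_bdry_eq_of_cover`), and joint continuity of the forward flow of a merely
continuous, uniquely integrable field (`continuousOn_flow`). -/

noncomputable section

/-! ### Affine chains in a simplex and their barycentric subdivision. -/

namespace SingularSubdivision

/-- The standard topological simplex with `n + 1` vertices. -/
abbrev Spx (n : ℕ) := stdSimplex ℝ (Fin (n + 1))

/-- The affine map between standard simplices with prescribed images of the vertices. -/
def aff {n k : ℕ} (v : Fin (n + 1) → Spx k) : C(Spx n, Spx k) where
  toFun t := ⟨∑ i, t i • (v i).1, (convex_stdSimplex ℝ _).sum_mem (fun i _ => t.2.1 i) t.2.2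
    (fun i _ => (v i).2)⟩
  continuous_toFun := by
    refine Continuous.subtype_mk (continuous_finsetSum _ fun i _ => ?_) _
    exact ((continuous_apply i).comp continuous_subtype_val).smul continuous_const

lemma aff_val {n k : ℕ} (v : Fin (n + 1) → Spx k) (t : Spx n) :
    (aff v t).1 = ∑ i, t i • (v i).1 := rfl

lemma aff_aff {n m k : ℕ} (v : Fin (m + 1) → Spx k) (w : Fin (n + 1) → Spx m) (t : Spx n) :
    aff (fun i => aff v (w i)) t = aff v (aff w t) := by
  apply Subtype.ext
  have h : ∀ j, (aff w t) j = ∑ i, t i * (w i) j := fun j => by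
    change (aff w t).1 j = _
    rw [aff_val, Finset.sum_apply]
    rfl
  simp only [aff_val, h, Finset.smul_sum, Finset.sum_smul, smul_smul]
  exact Finset.sum_comm

lemma aff_vertex {n k : ℕ} (v : Fin (n + 1) → Spx k) (i : Fin (n + 1)) :
    aff v (stdSimplex.vertex i) = v i := by
  apply Subtype.ext
  rw [aff_val, Finset.sum_eq_single i]
  · simp
  · intro j _ hj
    simp [hj]
  · simp

lemma aff_vertices (n : ℕ) : aff (fun i : Fin (n + 1) => (stdSimplex.vertex i : Spx n)) =
    ContinuousMap.id _ := by
  ext t j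
  change (aff _ t).1 j = t j
  rw [aff_val, Finset.sum_apply, Finset.sum_eq_single j]
  · simp
  · intro i _ hi
    simp [hi.symm]
  · simp

/-- The barycenter of a vertex sequence. -/
def bary {n k : ℕ} (v : Fin (n + 1) → Spx k) : Spx k := aff v stdSimplex.barycenter

lemma bary_aff {n m k : ℕ} (v : Fin (m + 1) → Spx k) (w : Fin (n + 1) → Spx m) :
    bary (fun i => aff v (w i)) = aff v (bary w) := aff_aff _ _ _

section AffineChains

/-- Affine chains: the free abelian group on sequences of `n` points of a simplex. -/
abbrev AffChain (k n : ℕ) := FreeAbelianGroup (Fin n → Spx k)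

variable {k m n : ℕ}

open FreeAbelianGroup (of)

/-- The cone operator on affine chains. -/
def cone (b : Spx k) : AffChain k n →+ AffChain k (n + 1) :=
  FreeAbelianGroup.lift fun v => of (Fin.cons b v : Fin (n + 1) → Spx k)

/-- The (augmented) boundary operator on affine chains. -/
def bd : AffChain k (n + 1) →+ AffChain k n :=
  FreeAbelianGroup.lift fun v => ∑ i : Fin (n + 1), (-1 : ℤ) ^ (i : ℕ) • of (v ∘ i.succAbove)

@[simp] lemma cone_of (b : Spx k) (v : Fin n → Spx k) :
    cone b (of v) = of (Fin.cons b v : Fin (n + 1) → Spx k) := FreeAbelianGroup.lift_apply_of _ _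

lemma bd_of (v : Fin (n + 1) → Spx k) :
    bd (of v) = ∑ i : Fin (n + 1), (-1 : ℤ) ^ (i : ℕ) • of (v ∘ i.succAbove) :=
  FreeAbelianGroup.lift_apply_of _ _

/-- Dropping the apex returns c; dropping any other vertex gives the cone on a face of c, with the
sign shifted by one. -/
lemma bd_cone (b : Spx k) (c : AffChain k (n + 1)) : bd (cone b c) = c - cone b (bd c) := by
  have : bd.comp (cone b) = AddMonoidHom.id (AffChain k (n + 1)) - (cone b).comp bd := by
    ext v
    simp only [AddMonoidHom.comp_apply, cone_of, bd_of, AddMonoidHom.sub_apply,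
      AddMonoidHom.id_apply, map_sum, map_zsmul]
    rw [Fin.sum_univ_succ, sub_eq_add_neg, ← Finset.sum_neg_distrib]
    congr 1
    refine Finset.sum_congr rfl fun i _ => ?_
    rw [Fin.val_succ, pow_succ, mul_neg, mul_one, neg_smul]
    congr 3
    funext j
    refine Fin.cases ?_ (fun j => ?_) j <;> simp
  exact DFunLike.congr_fun this c

/-- Chains on zero points are multiples of the empty sequence, the augmentation degree, where no
further boundary term exists. -/
lemma bd_cone_zero (b : Spx k) (c : AffChain k 0) : bd (cone b c) = c := by
  have : bd.comp (cone b) = AddMonoidHom.id (AffChain k 0) := by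
    ext v
    simp only [AddMonoidHom.comp_apply, cone_of, bd_of, AddMonoidHom.id_apply]
    simp only [Fin.sum_univ_succ, Fin.sum_univ_zero, Fin.val_zero, pow_zero, one_smul, add_zero]
    congr 1
  exact DFunLike.congr_fun this c

lemma exists_cone_of (v : Fin (n + 1) → Spx k) : of v = cone (v 0) (of (Fin.tail v)) := by
  rw [cone_of, Fin.cons_self_tail]

/-- Every generator is a cone, and the cone formula reduces the claim on cone c to the claim on c.
-/
lemma bd_bd : ∀ {n : ℕ} (c : AffChain k (n + 2)), bd (bd c) = 0
  | 0, c => by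
    have : (bd (n := 0)).comp (bd (n := 1)) = (0 : AffChain k 2 →+ _) := by
      ext v
      rw [AddMonoidHom.comp_apply, exists_cone_of, bd_cone, map_sub, bd_cone_zero, sub_self]
      rfl
    exact DFunLike.congr_fun this c
  | n + 1, c => by
    have : (bd (n := n + 1)).comp (bd (n := n + 2)) = (0 : AffChain k (n + 3) →+ _) := by
      ext v
      rw [AddMonoidHom.comp_apply, exists_cone_of, bd_cone, map_sub, bd_cone, bd_bd, map_zero,
        sub_zero, sub_self]
      rfl
    exact DFunLike.congr_fun this c

/-- Barycentric subdivision of affine chains. -/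
def sd : ∀ n : ℕ, AffChain k n →+ AffChain k n
  | 0 => AddMonoidHom.id _
  | n + 1 => FreeAbelianGroup.lift fun v => cone (bary v) (sd n (bd (of v)))

/-- The chain homotopy between barycentric subdivision and the identity. -/
def sdHtpy : ∀ n : ℕ, AffChain k n →+ AffChain k (n + 1)
  | 0 => 0
  | n + 1 => FreeAbelianGroup.lift fun v => cone (bary v) (of v - sdHtpy n (bd (of v)))

lemma sd_succ_of (v : Fin (n + 1) → Spx k) :
    sd (n + 1) (of v) = cone (bary v) (sd n (bd (of v))) := FreeAbelianGroup.lift_apply_of _ _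

lemma sdHtpy_succ_of (v : Fin (n + 1) → Spx k) :
    sdHtpy (n + 1) (of v) = cone (bary v) (of v - sdHtpy n (bd (of v))) :=
  FreeAbelianGroup.lift_apply_of _ _

/-- By the cone formula the error term is the cone on bd (sd (bd v)), which by induction is sd (bd
(bd v)) = 0. -/
lemma bd_sd : ∀ {n : ℕ} (c : AffChain k (n + 1)), bd (sd (n + 1) c) = sd n (bd c)
  | 0, c => by
    have : bd.comp (sd 1) = (sd 0).comp (bd (k := k)) := by
      ext v
      rw [AddMonoidHom.comp_apply, sd_succ_of, bd_cone_zero, AddMonoidHom.comp_apply]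
    exact DFunLike.congr_fun this c
  | n + 1, c => by
    have : bd.comp (sd (n + 2)) = (sd (n + 1)).comp (bd (k := k)) := by
      ext v
      rw [AddMonoidHom.comp_apply, sd_succ_of, bd_cone, bd_sd, bd_bd, map_zero, map_zero,
        sub_zero, AddMonoidHom.comp_apply]
    exact DFunLike.congr_fun this c

lemma bd_sdHtpy : ∀ {n : ℕ} (c : AffChain k (n + 1)),
    bd (sdHtpy (n + 1) c) = c - sd (n + 1) c - sdHtpy n (bd c)
  | 0, c => by
    have : bd.comp (sdHtpy 1) =
        AddMonoidHom.id _ - sd 1 - (sdHtpy 0).comp (bd (k := k)) := by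
      ext v
      simp only [AddMonoidHom.comp_apply, AddMonoidHom.sub_apply, sdHtpy_succ_of, bd_cone,
        sd_succ_of, AddMonoidHom.id_apply]
      simp [sdHtpy, sd]
    exact DFunLike.congr_fun this c
  | n + 1, c => by
    have : bd.comp (sdHtpy (n + 2)) =
        AddMonoidHom.id _ - sd (n + 2) - (sdHtpy (n + 1)).comp (bd (k := k)) := by
      ext v
      simp only [AddMonoidHom.comp_apply, AddMonoidHom.sub_apply, sdHtpy_succ_of, bd_cone,
        sd_succ_of, AddMonoidHom.id_apply, map_sub, bd_sdHtpy, bd_bd, map_zero]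
      abel
    exact DFunLike.congr_fun this c

/-- The map of affine chains induced by an affine map. -/
def push (v : Fin (m + 1) → Spx k) : AffChain m n →+ AffChain k n :=
  FreeAbelianGroup.lift fun w => of (aff v ∘ w)

@[simp] lemma push_of (v : Fin (m + 1) → Spx k) (w : Fin n → Spx m) :
    push v (of w) = of (aff v ∘ w) := FreeAbelianGroup.lift_apply_of _ _

lemma push_cone (v : Fin (m + 1) → Spx k) (b : Spx m) (c : AffChain m n) :
    push v (cone b c) = cone (aff v b) (push v c) := by
  have : (push v).comp (cone b) = (cone (aff v b)).comp (push (n := n) v) := by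
    ext w
    simp only [AddMonoidHom.comp_apply, cone_of, push_of]
    congr 1
    funext j
    refine Fin.cases ?_ (fun j => ?_) j <;> simp
  exact DFunLike.congr_fun this c

lemma push_bd (v : Fin (m + 1) → Spx k) (c : AffChain m (n + 1)) :
    push v (bd c) = bd (push v c) := by
  have : (push v).comp bd = bd.comp (push (n := n + 1) v) := by
    ext w
    simp only [AddMonoidHom.comp_apply, push_of, bd_of, map_sum, map_zsmul]
    rfl
  exact DFunLike.congr_fun this c

/-- Affine maps preserve cones, boundaries and barycenters, and subdivision is built from these
alone. -/
lemma push_sd (v : Fin (m + 1) → Spx k) : ∀ {n : ℕ} (c : AffChain m n),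
    push v (sd n c) = sd n (push v c)
  | 0, c => rfl
  | n + 1, c => by
    have : (push v).comp (sd (n + 1)) = (sd (n + 1)).comp (push v) := by
      ext w
      simp only [AddMonoidHom.comp_apply, push_of, sd_succ_of, push_cone, push_sd v, push_bd]
      rw [← bary_aff]
      rfl
    exact DFunLike.congr_fun this c

lemma push_sdHtpy (v : Fin (m + 1) → Spx k) : ∀ {n : ℕ} (c : AffChain m n),
    push v (sdHtpy n c) = sdHtpy n (push v c)
  | 0, c => by simp [sdHtpy]
  | n + 1, c => by
    have : (push v).comp (sdHtpy (n + 1)) = (sdHtpy (n + 1)).comp (push v) := by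
      ext w
      simp only [AddMonoidHom.comp_apply, push_of, sdHtpy_succ_of, push_cone, map_sub,
        push_sdHtpy v, push_bd]
      rw [← bary_aff]
      rfl
    exact DFunLike.congr_fun this c

/-- The affine chains all of whose simplices satisfy a given property. -/
def affIn (p : (Fin n → Spx k) → Prop) : AddSubgroup (AffChain k n) :=
  AddSubgroup.closure (of '' {v | p v})

lemma of_mem_affIn {p : (Fin n → Spx k) → Prop} {v : Fin n → Spx k} (h : p v) :
    of v ∈ affIn p := AddSubgroup.subset_closure ⟨v, h, rfl⟩

lemma affIn_map {A : Type*} [AddCommGroup A] {p : (Fin n → Spx k) → Prop} (H : AddSubgroup A)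
    (f : AffChain k n →+ A) (h : ∀ v, p v → f (of v) ∈ H) {c : AffChain k n} (hc : c ∈ affIn p) :
    f c ∈ H := by
  have : affIn p ≤ H.comap f := by
    rw [affIn, AddSubgroup.closure_le]
    rintro _ ⟨v, hv, rfl⟩
    exact h v hv
  exact this hc

/-- All vertices have distance at most `r` from `y`. -/
def nearPt (y : Spx k) (r : ℝ) (v : Fin n → Spx k) : Prop := ∀ i, dist y (v i) ≤ r

/-- All pairs of vertices have distance at most `r`. -/
def fine (r : ℝ) (v : Fin n → Spx k) : Prop := ∀ i j, dist (v i) (v j) ≤ r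

lemma dist_aff_le (y : Spx k) {r : ℝ} (v : Fin (n + 1) → Spx k) (h : nearPt y r v) (t : Spx n) :
    dist y (aff v t) ≤ r := by
  have := (convex_closedBall (y : Fin (k + 1) → ℝ) r).sum_mem (t := Finset.univ)
    (w := fun i => t i) (z := fun i => (v i).1) (fun i _ => t.2.1 i) t.2.2
    (fun i _ => by rw [Metric.mem_closedBall, dist_comm]; exact h i)
  rw [Metric.mem_closedBall, dist_comm] at this
  exact this

/-- In the mean of the n + 1 differences v j - v i the term j = i vanishes, which produces the
factor n / (n + 1). -/
lemma dist_bary_le {r : ℝ} (v : Fin (n + 1) → Spx k) (h : fine r v) (i : Fin (n + 1)) :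
    dist (bary v) (v i) ≤ n / (n + 1) * r := by
  have hn : (0 : ℝ) < n + 1 := by positivity
  have hr : 0 ≤ r := dist_nonneg.trans (h i i)
  have e : (bary v).1 - (v i).1 = ∑ j, ((n : ℝ) + 1)⁻¹ • ((v j).1 - (v i).1) := by
    rw [bary, aff_val]
    have : ∀ j : Fin (n + 1), (stdSimplex.barycenter (𝕜 := ℝ)) j = ((n : ℝ) + 1)⁻¹ := fun j => by
      refine (stdSimplex.barycenter_apply j).trans ?_
      simp
    simp only [this, smul_sub, Finset.sum_sub_distrib, Finset.sum_const, Finset.card_univ,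
      Fintype.card_fin, ← Nat.cast_smul_eq_nsmul ℝ, smul_smul]
    congr 1
    rw [Nat.cast_add, Nat.cast_one, mul_inv_cancel₀ hn.ne', one_smul]
  change dist (bary v).1 (v i).1 ≤ _
  rw [dist_eq_norm, e, ← Finset.add_sum_erase _ _ (Finset.mem_univ i), sub_self, smul_zero,
    zero_add]
  refine (norm_sum_le_of_le (n := fun _ => ((n : ℝ) + 1)⁻¹ * r) _ fun j _ => ?_).trans ?_
  · rw [norm_smul, Real.norm_of_nonneg (by positivity)]
    gcongr
    rw [← dist_eq_norm]
    exact h j i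
  · rw [Finset.sum_const, Finset.card_erase_of_mem (Finset.mem_univ i), Finset.card_univ,
      Fintype.card_fin, Nat.add_sub_cancel, nsmul_eq_mul]
    apply le_of_eq
    ring

lemma bd_nearPt (y : Spx k) (r : ℝ) {c : AffChain k (n + 1)} (hc : c ∈ affIn (nearPt y r)) :
    bd c ∈ affIn (nearPt y r) := by
  refine affIn_map _ bd (fun v hv => ?_) hc
  rw [bd_of]
  exact AddSubgroup.sum_mem _ fun i _ => AddSubgroup.zsmul_mem _
    (of_mem_affIn fun j => hv _) _

lemma bd_fine (r : ℝ) {c : AffChain k (n + 1)} (hc : c ∈ affIn (fine r)) :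
    bd c ∈ affIn (fine r) := by
  refine affIn_map _ bd (fun v hv => ?_) hc
  rw [bd_of]
  exact AddSubgroup.sum_mem _ fun i _ => AddSubgroup.zsmul_mem _
    (of_mem_affIn fun j l => hv _ _) _

lemma affIn_mono {p q : (Fin n → Spx k) → Prop} (h : ∀ v, p v → q v) : affIn p ≤ affIn q :=
  AddSubgroup.closure_mono (Set.image_mono h)

/-- Balls are convex, so the barycenters that subdivision introduces do not leave them. -/
lemma sd_nearPt (y : Spx k) (r : ℝ) : ∀ {n : ℕ} {c : AffChain k n}, c ∈ affIn (nearPt y r) →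
    sd n c ∈ affIn (nearPt y r)
  | 0, _, hc => hc
  | n + 1, c, hc => by
    refine affIn_map _ (sd (n + 1)) (fun v hv => ?_) hc
    rw [sd_succ_of]
    refine affIn_map _ (cone _) (fun w hw => ?_)
      (sd_nearPt y r (bd_nearPt y r (of_mem_affIn hv)))
    rw [cone_of]
    refine of_mem_affIn fun j => ?_
    refine Fin.cases ?_ (fun j => ?_) j
    · exact dist_aff_le y v hv _
    · exact hw j

/-- Membership is a condition on the support in the basis of simplices, so two conditions can be
imposed on the same simplices at once. -/
lemma affIn_and {p q : (Fin n → Spx k) → Prop} {c : AffChain k n} (hp : c ∈ affIn p)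
    (hq : c ∈ affIn q) : c ∈ affIn fun v => p v ∧ q v := by
  have key : ∀ (p : (Fin n → Spx k) → Prop) {c : AffChain k n}, c ∈ affIn p →
      ∀ v, ¬ p v → FreeAbelianGroup.toFinsupp c v = 0 := by
    intro p c hc
    induction hc using AddSubgroup.closure_induction with
    | mem x hx =>
      obtain ⟨v, hv, rfl⟩ := hx
      intro w hw
      rw [FreeAbelianGroup.toFinsupp_of, Finsupp.single_apply_eq_zero]
      rintro rfl
      exact absurd hv hw
    | zero => simp
    | add x y _ _ hx hy =>
      intro w hw
      rw [map_add, Finsupp.add_apply, hx w hw, hy w hw, add_zero]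
    | neg x _ hx =>
      intro w hw
      rw [map_neg, Finsupp.neg_apply, hx w hw, neg_zero]
  have h3 := FreeAbelianGroup.equivFinsupp (Fin n → Spx k) |>.symm_apply_apply c
  rw [← h3, ← Finsupp.sum_single (FreeAbelianGroup.equivFinsupp _ c), Finsupp.sum, map_sum]
  refine AddSubgroup.sum_mem _ fun v hv => ?_
  change Finsupp.toFreeAbelianGroup _ ∈ _
  simp only [Finsupp.toFreeAbelianGroup, Finsupp.liftAddHom_apply_single, AddMonoidHom.flip_apply,
    smulAddHom_apply]
  exact AddSubgroup.zsmul_mem _ (of_mem_affIn ⟨by_contra fun h =>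
    Finsupp.mem_support_iff.1 hv (key p hp v h), by_contra fun h =>
    Finsupp.mem_support_iff.1 hv (key q hq v h)⟩) _

/-- A new simplex has the barycenter as apex and a base in the subdivided boundary. Distances within
the base shrink by induction; distances to the apex are bounded by `dist_bary_le`, as the base stays
in a ball around the apex. The index counts points, so the factor is d / (d + 1) in dimension d; for
n = 0 it is 0 / 0 = 0 and the claim is vacuous. -/
lemma sd_fine {r : ℝ} (hr : 0 ≤ r) : ∀ {n : ℕ} {c : AffChain k n}, c ∈ affIn (fine r) →
    sd n c ∈ affIn (fine ((n - 1 : ℕ) / n * r))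
  | 0, _, hc => affIn_map _ (sd 0) (fun v hv => of_mem_affIn fun i => i.elim0) hc
  | n + 1, c, hc => by
    refine affIn_map _ (sd (n + 1)) (fun v hv => ?_) hc
    rw [sd_succ_of]
    have h1 := sd_fine hr (bd_fine r (of_mem_affIn hv))
    have h2 : of v ∈ affIn (nearPt (bary v) (n / (n + 1) * r)) :=
      of_mem_affIn (dist_bary_le v hv)
    have h3 := sd_nearPt _ _ (bd_nearPt _ _ h2)
    refine affIn_map _ (cone _) (fun w hw => ?_) (affIn_and h1 h3)
    rw [cone_of]
    have h4 : ((n - 1 : ℕ) : ℝ) / n * r ≤ n / (n + 1) * r := by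
      refine mul_le_mul_of_nonneg_right ?_ hr
      rcases n with _ | n
      · simp
      · rw [Nat.add_sub_cancel, div_le_div_iff₀ (by positivity) (by positivity)]
        push_cast
        nlinarith
    have h5 : (0 : ℝ) ≤ n / (n + 1) * r := by positivity
    refine of_mem_affIn fun i j => ?_
    rw [Nat.add_sub_cancel, Nat.cast_add, Nat.cast_one]
    refine Fin.cases ?_ (fun i => ?_) i <;> refine Fin.cases ?_ (fun j => ?_) j
    · simpa using h5
    · simpa using hw.2 j
    · rw [dist_comm]
      simpa using hw.2 i
    · simpa using (hw.1 i j).trans h4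

/-- The diameter decays geometrically. The conclusion covers all m ≥ N so that finitely many
simplices can share one m. -/
lemma exists_sd_iterate_fine (c : AffChain k (n + 1)) {r : ℝ} (hr : 0 < r)
    (hc : c ∈ affIn (fine 1)) : ∃ N, ∀ m ≥ N, (sd (n + 1))^[m] c ∈ affIn (fine r) := by
  have key : ∀ m : ℕ, (sd (n + 1))^[m] c ∈ affIn (fine (((n : ℝ) / (n + 1)) ^ m)) := by
    intro m
    induction m with
    | zero => simpa using hc
    | succ m ih =>
      rw [Function.iterate_succ_apply']
      have := sd_fine (by positivity) ih
      rw [Nat.add_sub_cancel, Nat.cast_add, Nat.cast_one, ← pow_succ'] at this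
      exact this
  have hlim : Tendsto (fun m : ℕ => ((n : ℝ) / (n + 1)) ^ m) atTop (𝓝 0) :=
    tendsto_pow_atTop_nhds_zero_of_lt_one (by positivity)
      ((div_lt_one (by positivity)).2 (by linarith))
  obtain ⟨N, hN⟩ := eventually_atTop.1 (hlim.eventually (gt_mem_nhds hr))
  exact ⟨N, fun m hm => affIn_mono (fun v hv i j => (hv i j).trans (hN m hm).le) (key m)⟩

end AffineChains

end SingularSubdivision

/-! ### Singular chains, small simplices and Mayer–Vietoris at chain level. -/

namespace SingularSubdivision

section SingularChains

open FreeAbelianGroup (of)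

variable (Z : Type*) [TopologicalSpace Z] (G : Type*) [AddCommGroup G]

/-- Singular chains with coefficients in `G`. -/
abbrev Chain (n : ℕ) := C(Spx n, Z) →₀ G

variable {Z G} {n k : ℕ}

/-- The inclusion of a face of a standard simplex. -/
def face (i : Fin (n + 2)) : C(Spx n, Spx (n + 1)) :=
  aff fun j => stdSimplex.vertex (i.succAbove j)

/-- Realization of affine chains as singular chains through a singular simplex. -/
def realize (σ : C(Spx k, Z)) (g : G) : AffChain k (n + 1) →+ Chain Z G n :=
  FreeAbelianGroup.lift fun v => Finsupp.single (σ.comp (aff v)) g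

@[simp] lemma realize_of (σ : C(Spx k, Z)) (g : G) (v : Fin (n + 1) → Spx k) :
    realize σ g (of v) = Finsupp.single (σ.comp (aff v)) g := FreeAbelianGroup.lift_apply_of _ _

lemma realize_add (σ : C(Spx k, Z)) (g g' : G) (c : AffChain k (n + 1)) :
    realize σ (g + g') c = realize σ g c + realize σ g' c := by
  have : realize (n := n) σ (g + g') = realize σ g + realize σ g' := by
    ext v : 1
    simp
  exact DFunLike.congr_fun this c

lemma realize_zero (σ : C(Spx k, Z)) (c : AffChain k (n + 1)) :
    realize σ (0 : G) c = 0 := by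
  have : realize (n := n) σ (0 : G) = 0 := by
    ext v : 1
    simp
  exact DFunLike.congr_fun this c

/-- Extend a universal affine chain to a natural operator on singular chains. -/
def operator (c : AffChain k (n + 1)) : Chain Z G k →+ Chain Z G n :=
  Finsupp.liftAddHom fun σ =>
    { toFun := fun g => realize σ g c
      map_zero' := realize_zero σ c
      map_add' := fun g g' => realize_add σ g g' c }

@[simp] lemma operator_single (c : AffChain k (n + 1)) (σ : C(Spx k, Z)) (g : G) :
    operator c (Finsupp.single σ g) = realize σ g c := by
  rw [operator, Finsupp.liftAddHom_apply_single]
  rfl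

/-- The vertices of the standard simplex as an affine chain. -/
def vertices (n : ℕ) : AffChain n (n + 1) := of fun i => stdSimplex.vertex i

lemma realize_vertices (σ : C(Spx n, Z)) (g : G) :
    realize σ g (vertices n) = Finsupp.single σ g := by
  rw [vertices, realize_of, aff_vertices, ContinuousMap.comp_id]

lemma push_vertices (v : Fin (n + 1) → Spx k) : push v (vertices n) = of v := by
  rw [vertices, push_of]
  congr 1
  funext i
  exact aff_vertex v i

lemma realize_push {m : ℕ} (σ : C(Spx k, Z)) (g : G) (v : Fin (m + 1) → Spx k)
    (c : AffChain m (n + 1)) : realize σ g (push v c) = realize (σ.comp (aff v)) g c := by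
  have : (realize σ g).comp (push v) = realize (n := n) (σ.comp (aff v)) g := by
    ext w : 1
    simp only [AddMonoidHom.comp_apply, push_of, realize_of]
    congr 1
    ext t
    exact congrArg σ (aff_aff v w t)
  exact DFunLike.congr_fun this c

/-- The boundary operator on singular chains. -/
def bdry : Chain Z G (n + 1) →+ Chain Z G n :=
  Finsupp.liftAddHom fun σ =>
    ∑ i : Fin (n + 2), (-1 : ℤ) ^ (i : ℕ) • Finsupp.singleAddHom (σ.comp (face i))

lemma bdry_single (σ : C(Spx (n + 1), Z)) (g : G) : bdry (Finsupp.single σ g) =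
    ∑ i : Fin (n + 2), (-1 : ℤ) ^ (i : ℕ) • Finsupp.single (σ.comp (face i)) g := by
  simp [bdry]

/-- Since each singular simplex is the realization of `vertices` through itself, this carries
identities between affine chains over to singular chains. -/
lemma bdry_realize (σ : C(Spx k, Z)) (g : G) (c : AffChain k (n + 2)) :
    bdry (realize σ g c) = realize σ g (bd c) := by
  have : bdry.comp (realize (n := n + 1) σ g) = (realize σ g).comp bd := by
    ext v : 1
    simp only [AddMonoidHom.comp_apply, realize_of, bdry_single, bd_of, map_sum, map_zsmul]
    refine Finset.sum_congr rfl fun i _ => ?_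
    congr 2
    ext t
    refine congrArg σ ?_
    rw [← ContinuousMap.comp_apply]
    rw [ContinuousMap.comp_apply, face, ← aff_aff]
    congr 2
    funext j
    exact aff_vertex v _
  exact DFunLike.congr_fun this c

lemma bdry_bdry (c : Chain Z G (n + 2)) : bdry (bdry c) = 0 := by
  have : bdry.comp (bdry (Z := Z) (G := G) (n := n + 1)) = 0 := by
    refine Finsupp.addHom_ext fun σ g => ?_
    rw [AddMonoidHom.comp_apply, ← realize_vertices σ g, bdry_realize, bdry_realize, bd_bd,
      map_zero]
    rfl
  exact DFunLike.congr_fun this c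

/-- Barycentric subdivision of singular chains. -/
def subdiv : Chain Z G n →+ Chain Z G n := operator (sd (n + 1) (vertices n))

/-- The chain homotopy between barycentric subdivision and the identity. -/
def subdivHtpy : Chain Z G n →+ Chain Z G (n + 1) := operator (sdHtpy (n + 1) (vertices n))

/-- Both sides are realizations through σ of affine chains, which agree by the naturality `push_sd`.
-/
lemma subdiv_realize (σ : C(Spx k, Z)) (g : G) (c : AffChain k (n + 1)) :
    subdiv (realize σ g c) = realize σ g (sd (n + 1) c) := by
  have : subdiv.comp (realize (n := n) σ g) = (realize σ g).comp (sd (n + 1)) := by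
    ext v : 1
    simp only [AddMonoidHom.comp_apply, realize_of, subdiv, operator_single]
    rw [← realize_push, push_sd, push_vertices]
  exact DFunLike.congr_fun this c

lemma subdivHtpy_realize (σ : C(Spx k, Z)) (g : G) (c : AffChain k (n + 1)) :
    subdivHtpy (realize σ g c) = realize σ g (sdHtpy (n + 1) c) := by
  have : subdivHtpy.comp (realize (n := n) σ g) = (realize σ g).comp (sdHtpy (n + 1)) := by
    ext v : 1
    simp only [AddMonoidHom.comp_apply, realize_of, subdivHtpy, operator_single]
    rw [← realize_push, push_sdHtpy, push_vertices]
  exact DFunLike.congr_fun this c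

lemma bdry_subdiv (c : Chain Z G (n + 1)) : bdry (subdiv c) = subdiv (bdry c) := by
  have : bdry.comp (subdiv (Z := Z) (G := G) (n := n + 1)) = subdiv.comp bdry := by
    refine Finsupp.addHom_ext fun σ g => ?_
    simp only [AddMonoidHom.comp_apply]
    rw [← realize_vertices σ g, subdiv_realize, bdry_realize, bdry_realize, subdiv_realize, bd_sd]
  exact DFunLike.congr_fun this c

lemma bdry_subdivHtpy (c : Chain Z G (n + 1)) :
    bdry (subdivHtpy c) = c - subdiv c - subdivHtpy (bdry c) := by
  have : bdry.comp (subdivHtpy (Z := Z) (G := G) (n := n + 1)) =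
      AddMonoidHom.id _ - subdiv - subdivHtpy.comp bdry := by
    refine Finsupp.addHom_ext fun σ g => ?_
    simp only [AddMonoidHom.comp_apply, AddMonoidHom.sub_apply, AddMonoidHom.id_apply]
    rw [← realize_vertices σ g, subdiv_realize, bdry_realize, subdivHtpy_realize, bdry_realize,
      subdivHtpy_realize, bd_sdHtpy, map_sub, map_sub]
  exact DFunLike.congr_fun this c

lemma bdry_subdivHtpy_zero (c : Chain Z G 0) : bdry (subdivHtpy c) = c - subdiv c := by
  have : bdry.comp (subdivHtpy (Z := Z) (G := G) (n := 0)) = AddMonoidHom.id _ - subdiv := by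
    refine Finsupp.addHom_ext fun σ g => ?_
    simp only [AddMonoidHom.comp_apply, AddMonoidHom.sub_apply, AddMonoidHom.id_apply]
    rw [← realize_vertices σ g, subdiv_realize, subdivHtpy_realize, bdry_realize, bd_sdHtpy,
      map_sub, map_sub]
    simp [sdHtpy]
  exact DFunLike.congr_fun this c

/-- A chain is a cycle, where every `0`-chain is one. -/
def IsCycle : ∀ {n : ℕ}, Chain Z G n → Prop
  | 0, _ => True
  | _ + 1, c => bdry c = 0

lemma IsCycle.subdiv : ∀ {n : ℕ} {c : Chain Z G n}, IsCycle c → IsCycle (subdiv c)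
  | 0, _, _ => trivial
  | n + 1, c, (h : bdry c = 0) => by
    change bdry _ = 0
    rw [bdry_subdiv, h, map_zero]

lemma IsCycle.bdry_subdivHtpy : ∀ {n : ℕ} {c : Chain Z G n}, IsCycle c →
    bdry (subdivHtpy c) = c - SingularSubdivision.subdiv c
  | 0, c, _ => bdry_subdivHtpy_zero c
  | n + 1, c, (h : bdry c = 0) => by
    rw [SingularSubdivision.bdry_subdivHtpy, h, map_zero, sub_zero]

/-- The singular chains whose simplices lie in `Q`. -/
def chainsIn (G : Type*) [AddCommGroup G] (n : ℕ) (Q : Set Z) : AddSubgroup (Chain Z G n) where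
  carrier := {c | ∀ σ ∈ c.support, ∀ t, σ t ∈ Q}
  zero_mem' := by simp
  add_mem' := by
    classical
    intro a b ha hb σ hσ
    rcases Finset.mem_union.1 (Finsupp.support_add hσ) with h | h
    · exact ha σ h
    · exact hb σ h
  neg_mem' := by
    intro a ha σ hσ
    rw [Finsupp.support_neg] at hσ
    exact ha σ hσ

lemma single_mem_chainsIn {Q : Set Z} {σ : C(Spx n, Z)} (g : G) (h : ∀ t, σ t ∈ Q) :
    Finsupp.single σ g ∈ chainsIn G n Q := by
  intro τ hτ
  have := Finsupp.support_single_subset hτ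
  rw [Finset.mem_singleton] at this
  exact this ▸ h

lemma chainsIn_map {A : Type*} [AddCommGroup A] {Q : Set Z} (H : AddSubgroup A)
    (f : Chain Z G n →+ A) (h : ∀ σ g, (∀ t, σ t ∈ Q) → f (Finsupp.single σ g) ∈ H)
    {c : Chain Z G n} (hc : c ∈ chainsIn G n Q) : f c ∈ H := by
  rw [← Finsupp.sum_single c, Finsupp.sum, map_sum]
  exact AddSubgroup.sum_mem _ fun σ hσ => h σ _ (hc σ hσ)

lemma realize_mem {Q : Set Z} {σ : C(Spx k, Z)} (g : G) (h : ∀ t, σ t ∈ Q)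
    (c : AffChain k (n + 1)) : realize σ g c ∈ chainsIn G n Q := by
  induction c using FreeAbelianGroup.induction_on with
  | zero => rw [map_zero]; exact zero_mem _
  | of v => rw [realize_of]; exact single_mem_chainsIn g fun t => h _
  | neg v hv => rw [map_neg]; exact neg_mem hv
  | add x y hx hy => rw [map_add]; exact add_mem hx hy

lemma operator_mem {Q : Set Z} (a : AffChain k (n + 1)) {c : Chain Z G k}
    (hc : c ∈ chainsIn G k Q) : operator a c ∈ chainsIn G n Q :=
  chainsIn_map _ (operator a) (fun σ g h => by
    rw [operator_single]; exact realize_mem g h a) hc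

lemma bdry_mem {Q : Set Z} {c : Chain Z G (n + 1)} (hc : c ∈ chainsIn G (n + 1) Q) :
    bdry c ∈ chainsIn G n Q :=
  chainsIn_map _ bdry (fun σ g h => by
    rw [bdry_single]
    refine AddSubgroup.sum_mem _ fun i _ => AddSubgroup.zsmul_mem _ ?_ _
    exact single_mem_chainsIn g fun t => h _) hc

lemma subdiv_iterate_mem {Q : Set Z} {c : Chain Z G n} (hc : c ∈ chainsIn G n Q) (m : ℕ) :
    subdiv^[m] c ∈ chainsIn G n Q := by
  induction m with
  | zero => exact hc
  | succ m ih => rw [Function.iterate_succ_apply']; exact operator_mem _ ih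

lemma bdry_subdiv_iterate (c : Chain Z G (n + 1)) (m : ℕ) :
    bdry (subdiv^[m] c) = subdiv^[m] (bdry c) := by
  induction m with
  | zero => rfl
  | succ m ih => rw [Function.iterate_succ_apply', Function.iterate_succ_apply', bdry_subdiv, ih]

/-- Telescoping: e is the sum of `subdivHtpy` applied to the successive subdivisions of c, and these
operators never leave Q. -/
lemma exists_bdry_eq_sub_subdiv_iterate {Q : Set Z} {c : Chain Z G n} (hc : c ∈ chainsIn G n Q)
    (h : IsCycle c) (m : ℕ) :
    ∃ e ∈ chainsIn G (n + 1) Q, bdry e = c - subdiv^[m] c := by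
  have hcyc : ∀ m, IsCycle (subdiv^[m] c) := fun m => by
    induction m with
    | zero => exact h
    | succ m ih => rw [Function.iterate_succ_apply']; exact ih.subdiv
  induction m with
  | zero => exact ⟨0, zero_mem _, by simp⟩
  | succ m ih =>
    obtain ⟨e, he, hbe⟩ := ih
    refine ⟨e + subdivHtpy (subdiv^[m] c), add_mem he (operator_mem _ (subdiv_iterate_mem hc m)),
      ?_⟩
    rw [map_add, hbe, (hcyc m).bdry_subdivHtpy, Function.iterate_succ_apply']
    abel

lemma subdiv_iterate_realize (σ : C(Spx k, Z)) (g : G) (c : AffChain k (n + 1)) (m : ℕ) :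
    subdiv^[m] (realize σ g c) = realize σ g ((sd (n + 1))^[m] c) := by
  induction m with
  | zero => rfl
  | succ m ih => rw [Function.iterate_succ_apply', Function.iterate_succ_apply', ih,
      subdiv_realize]

/-- Take a Lebesgue number δ of the preimages of O and P in the simplex. Once the subdivision has
mesh at most δ / 2, each piece lies in the δ-ball around its first vertex, hence in one of the two
preimages. -/
lemma exists_subdiv_iterate_single_mem {O P : Set Z} (hO : IsOpen O) (hP : IsOpen P)
    (hOP : O ∪ P = univ) (σ : C(Spx n, Z)) (g : G) :
    ∃ N, ∀ m ≥ N, subdiv^[m] (Finsupp.single σ g) ∈ chainsIn G n O ⊔ chainsIn G n P := by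
  obtain ⟨δ, hδ, hL⟩ := lebesgue_number_lemma_of_metric (s := (univ : Set (Spx n)))
    (c := fun b : Bool => σ ⁻¹' (if b then O else P)) isCompact_univ
    (fun b => by cases b <;> simp only [if_true, if_false, Bool.false_eq_true]
                 · exact hP.preimage σ.continuous
                 · exact hO.preimage σ.continuous)
    (fun t _ => by
      have : σ t ∈ O ∪ P := hOP ▸ mem_univ _
      rcases this with h | h
      · exact mem_iUnion.2 ⟨true, by simpa using h⟩
      · exact mem_iUnion.2 ⟨false, by simpa using h⟩)
  obtain ⟨N, hN⟩ := exists_sd_iterate_fine (vertices n) (half_pos hδ)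
    -- The standard simplex has diameter at most 1, which starts the decay.
    (of_mem_affIn fun i j => by
      rw [Subtype.dist_eq]
      exact (Metric.dist_le_diam_of_mem (bounded_stdSimplex _) (Subtype.mem _)
        (Subtype.mem _)).trans diam_stdSimplex_le)
  refine ⟨N, fun m hm => ?_⟩
  rw [← realize_vertices σ g, subdiv_iterate_realize]
  refine affIn_map _ (realize σ g) (fun v hv => ?_) (hN m hm)
  rw [realize_of]
  have hb : ∀ t, aff v t ∈ Metric.ball (v 0) δ := fun t => by
    rw [Metric.mem_ball, dist_comm]
    exact (dist_aff_le (v 0) v (fun i => hv 0 i) t).trans_lt (half_lt_self hδ)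
  obtain ⟨b, hb'⟩ := hL (v 0) (mem_univ _)
  cases b
  · exact AddSubgroup.mem_sup_right (single_mem_chainsIn g fun t => by simpa using hb' (hb t))
  · exact AddSubgroup.mem_sup_left (single_mem_chainsIn g fun t => by simpa using hb' (hb t))

lemma exists_subdiv_iterate_mem {O P : Set Z} (hO : IsOpen O) (hP : IsOpen P)
    (hOP : O ∪ P = univ) (c : Chain Z G n) :
    ∃ N, ∀ m ≥ N, subdiv^[m] c ∈ chainsIn G n O ⊔ chainsIn G n P := by
  induction c using Finsupp.induction_linear with
  | zero => exact ⟨0, fun m _ => by rw [iterate_map_zero]; exact zero_mem _⟩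
  | add a b ha hb =>
    obtain ⟨N, hN⟩ := ha
    obtain ⟨N', hN'⟩ := hb
    refine ⟨max N N', fun m hm => ?_⟩
    rw [iterate_map_add]
    exact add_mem (hN m (le_of_max_le_left hm)) (hN' m (le_of_max_le_right hm))
  | single σ g => exact exists_subdiv_iterate_single_mem hO hP hOP σ g

/-- The Mayer–Vietoris argument at chain level. -/
theorem exists_bdry_eq_of_cover {O P : Set Z} (hO : IsOpen O) (hP : IsOpen P)
    (hOP : O ∪ P = univ) {a : Chain Z G n} (ha : a ∈ chainsIn G n (O ∩ P)) (hcyc : IsCycle a)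
    {b c : Chain Z G (n + 1)} (hb : b ∈ chainsIn G (n + 1) O) (hc : c ∈ chainsIn G (n + 1) P)
    (hba : bdry b = a) {e : Chain Z G (n + 2)} (he : bdry e = b - c) :
    ∃ q ∈ chainsIn G (n + 1) (O ∩ P), bdry q = a := by
  -- After subdivision the chain connecting b and c splits into a part in O and a part in P.
  obtain ⟨m, hm⟩ := exists_subdiv_iterate_mem hO hP hOP e
  obtain ⟨eO, heO, eP, heP, hsum⟩ := AddSubgroup.mem_sup.1 (hm m le_rfl)
  obtain ⟨D, hD, hbD⟩ := exists_bdry_eq_sub_subdiv_iterate ha hcyc m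
  -- The left side lives in O and the right side in P, so this common chain lives in O ∩ P.
  have key : subdiv^[m] b - bdry eO = subdiv^[m] c + bdry eP := by
    have h := bdry_subdiv_iterate e m
    rw [he, iterate_map_sub, ← hsum, map_add] at h
    rw [← sub_eq_zero]
    rw [← sub_eq_zero] at h
    rw [← neg_eq_zero, ← h]
    abel
  have hq : subdiv^[m] b - bdry eO ∈ chainsIn G (n + 1) (O ∩ P) := by
    have h1 : subdiv^[m] b - bdry eO ∈ chainsIn G (n + 1) O :=
      sub_mem (subdiv_iterate_mem hb m) (bdry_mem heO)
    have h2 : subdiv^[m] b - bdry eO ∈ chainsIn G (n + 1) P :=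
      key ▸ add_mem (subdiv_iterate_mem hc m) (bdry_mem heP)
    exact fun σ hσ t => ⟨h1 σ hσ t, h2 σ hσ t⟩
  -- The common chain bounds the subdivision of a; D corrects this to a itself inside O ∩ P.
  refine ⟨subdiv^[m] b - bdry eO + D, add_mem hq hD, ?_⟩
  rw [map_add, map_sub, bdry_bdry, sub_zero, hbD, bdry_subdiv_iterate, hba]
  abel

end SingularChains

end SingularSubdivision

/-! ### Comparison of concrete chains with Mathlib's singular homology. -/

namespace SingularSubdivision

section Comparison

open CategoryTheory AlgebraicTopology Simplicial

section AbelianComplex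

variable (K : ChainComplex AddCommGrpCat.{u} ℕ) (k : ℕ)

lemma exists_homologyπ_eq (x : K.homology k) : ∃ z : K.cycles k, K.homologyπ k z = x :=
  (AddCommGrpCat.epi_iff_surjective _).1 (inferInstance : Epi (K.homologyπ k)) x

lemma iCycles_injective : Function.Injective (K.iCycles k) :=
  (AddCommGrpCat.mono_iff_injective _).1 inferInstance

lemma homologyπ_eq_zero_iff (z : K.cycles k) :
    K.homologyπ k z = 0 ↔ ∃ b : K.X (k + 1), K.d (k + 1) k b = K.iCycles k z := by
  have hex : (ShortComplex.mk (K.toCycles (k + 1) k) (K.homologyπ k) (by simp)).Exact :=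
    ShortComplex.exact_of_g_is_cokernel _ (K.homologyIsCokernel (k + 1) k (by simp))
  constructor
  · intro h
    obtain ⟨b, hb⟩ := (ShortComplex.ab_exact_iff _).1 hex z h
    refine ⟨b, ?_⟩
    rw [← hb, ← ConcreteCategory.comp_apply, HomologicalComplex.toCycles_i]
  · rintro ⟨b, hb⟩
    have : K.toCycles (k + 1) k b = z := by
      apply iCycles_injective
      rw [← hb, ← ConcreteCategory.comp_apply, HomologicalComplex.toCycles_i]
    rw [← this, ← ConcreteCategory.comp_apply, HomologicalComplex.toCycles_comp_homologyπ]
    rfl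

lemma d_iCycles (j : ℕ) (z : K.cycles k) : K.d k j (K.iCycles k z) = 0 := by
  rw [← ConcreteCategory.comp_apply, HomologicalComplex.iCycles_d]
  rfl

lemma exists_iCycles_eq (c : K.X (k + 1)) (hc : K.d (k + 1) k c = 0) :
    ∃ z : K.cycles (k + 1), K.iCycles (k + 1) z = c := by
  have hex : (ShortComplex.mk (K.iCycles (k + 1)) (K.d (k + 1) k) (by simp)).Exact :=
    ShortComplex.exact_of_f_is_kernel _ (K.cyclesIsKernel (k + 1) k (by simp))
  exact (ShortComplex.ab_exact_iff _).1 hex c hc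

variable {K} {K' : ChainComplex AddCommGrpCat.{u} ℕ} (φ : K ⟶ K')

lemma homologyMap_homologyπ (z : K.cycles k) :
    HomologicalComplex.homologyMap φ k (K.homologyπ k z) =
      K'.homologyπ k (HomologicalComplex.cyclesMap φ k z) := by
  rw [← ConcreteCategory.comp_apply, HomologicalComplex.homologyπ_naturality]
  rfl

lemma iCycles_cyclesMap (z : K.cycles k) :
    K'.iCycles k (HomologicalComplex.cyclesMap φ k z) = φ.f k (K.iCycles k z) := by
  rw [← ConcreteCategory.comp_apply, HomologicalComplex.cyclesMap_i]
  rfl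

lemma map_d (i j : ℕ) (c : K.X i) : φ.f j (K.d i j c) = K'.d i j (φ.f i c) := by
  rw [← ConcreteCategory.comp_apply, ← φ.comm]
  rfl

end AbelianComplex

variable (Z : Type u) [TopologicalSpace Z] (G : Type u) [AddCommGroup G]

lemma sum_hom_apply {ι : Type*} [Fintype ι] {A B : AddCommGrpCat.{u}} (f : ι → (A ⟶ B)) (a : A) :
    (∑ i, f i) a = ∑ i, f i a := by
  let ev : (A ⟶ B) →+ B := { toFun := fun f => f a, map_zero' := rfl, map_add' := fun _ _ => rfl }
  exact map_sum ev f _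

/-- The singular chain complex of Mathlib. -/
abbrev singularComplex : ChainComplex AddCommGrpCat.{u} ℕ :=
  (TopCat.toSSet.obj (TopCat.of Z)).chainComplex (AddCommGrpCat.of G)

/-- The inclusion of the summand of singular chains given by a simplex. -/
def simplexHom {n : ℕ} (x : (TopCat.toSSet.obj (TopCat.of Z)) _⦋n⦌) :
    G →+ (singularComplex Z G).X n :=
  AddCommGrpCat.Hom.hom
    ((TopCat.toSSet.obj (TopCat.of Z)).ιChainComplex (R := AddCommGrpCat.of G) x)

/-- The isomorphism of concrete singular chains with those of Mathlib, as a map. -/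
def toComplex (n : ℕ) : Chain Z G n →+ (singularComplex Z G).X n :=
  Finsupp.liftAddHom fun σ =>
    simplexHom Z G (((TopCat.of Z).toSSetObjEquiv (.op ⦋n⦌)).symm σ)

variable {Z G}

lemma toComplex_single {n : ℕ} (x : (TopCat.toSSet.obj (TopCat.of Z)) _⦋n⦌) (g : G) :
    toComplex Z G n (Finsupp.single ((TopCat.of Z).toSSetObjEquiv (.op ⦋n⦌) x) g) =
      simplexHom Z G x g := by
  rw [toComplex, Finsupp.liftAddHom_apply_single, Equiv.symm_apply_apply]

/-- Mathlib's chain group is a coproduct of copies of G over the simplices; the inverse comes from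
its universal property. -/
lemma toComplex_bijective (n : ℕ) : Function.Bijective (toComplex Z G n) := by
  let inv : (singularComplex Z G).X n ⟶ AddCommGrpCat.of (Chain Z G n) :=
    Limits.Sigma.desc fun x => AddCommGrpCat.ofHom
      (Finsupp.singleAddHom ((TopCat.of Z).toSSetObjEquiv (.op ⦋n⦌) x))
  have hinv : ∀ x, (TopCat.toSSet.obj (TopCat.of Z)).ιChainComplex (R := AddCommGrpCat.of G) x ≫
      inv = AddCommGrpCat.ofHom
        (Finsupp.singleAddHom ((TopCat.of Z).toSSetObjEquiv (.op ⦋n⦌) x)) :=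
    fun x => Limits.Sigma.ι_desc _ _
  have h1 : ∀ c, inv (toComplex Z G n c) = c := by
    intro c
    have : (AddCommGrpCat.Hom.hom inv).comp (toComplex Z G n) = AddMonoidHom.id _ := by
      refine Finsupp.addHom_ext fun σ g => ?_
      obtain ⟨x, rfl⟩ := ((TopCat.of Z).toSSetObjEquiv (.op ⦋n⦌)).surjective σ
      rw [AddMonoidHom.comp_apply, toComplex_single]
      exact congr($(hinv x) g)
    exact DFunLike.congr_fun this c
  have h2 : inv ≫ AddCommGrpCat.ofHom (toComplex Z G n) = 𝟙 _ := by
    refine SSet.chainComplex_hom_ext fun x => ?_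
    refine (Category.assoc _ _ _).symm.trans ?_
    have h3 := congrArg (fun f => f ≫ AddCommGrpCat.ofHom (toComplex Z G n)) (hinv x)
    refine h3.trans ?_
    ext g
    exact toComplex_single x g
  exact ⟨Function.LeftInverse.injective h1, fun y => ⟨inv y, congr($h2 y)⟩⟩

lemma map_succAbove_eq_face {n : ℕ} (i : Fin (n + 2)) (t : Spx n) :
    stdSimplex.map i.succAbove t = face i t := by
  apply Subtype.ext
  funext j
  change FunOnFinite.linearMap ℝ ℝ i.succAbove t j = (face i t).1 j
  rw [FunOnFinite.linearMap_apply_apply, face, aff_val, Finset.sum_apply, Finset.sum_filter]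
  refine Finset.sum_congr rfl fun l _ => ?_
  simp [Pi.single_apply, eq_comm]

lemma toComplex_bdry {n : ℕ} (c : Chain Z G (n + 1)) :
    toComplex Z G n (bdry c) = (singularComplex Z G).d (n + 1) n (toComplex Z G (n + 1) c) := by
  have : (toComplex Z G n).comp bdry =
      (AddCommGrpCat.Hom.hom ((singularComplex Z G).d (n + 1) n)).comp (toComplex Z G (n + 1)) := by
    refine Finsupp.addHom_ext fun σ g => ?_
    obtain ⟨x, rfl⟩ := ((TopCat.of Z).toSSetObjEquiv (.op ⦋n + 1⦌)).surjective σ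
    rw [AddMonoidHom.comp_apply, AddMonoidHom.comp_apply, toComplex_single, bdry_single, map_sum]
    have h := congr($((TopCat.toSSet.obj (TopCat.of Z)).ιChainComplex_d (AddCommGrpCat.of G) x) g)
    refine Eq.trans ?_ (h.trans (sum_hom_apply _ _)).symm
    refine Finset.sum_congr rfl fun i _ => ?_
    rw [map_zsmul]
    refine congrArg _ ?_
    refine Eq.trans ?_ (toComplex_single ((TopCat.toSSet.obj (TopCat.of Z)).δ i x) g)
    congr 2
    ext t
    exact congrArg ((TopCat.of Z).toSSetObjEquiv (.op ⦋n + 1⦌) x) (map_succAbove_eq_face i t).symm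
  exact DFunLike.congr_fun this c

variable {W : Type u} [TopologicalSpace W]

/-- The map of singular chains induced by a continuous map. -/
def chainMap (f : C(W, Z)) (n : ℕ) : Chain W G n →+ Chain Z G n :=
  Finsupp.mapDomain.addMonoidHom fun σ => f.comp σ

/-- The map of singular chain complexes induced by a continuous map. -/
abbrev singularComplexMap (G : Type u) [AddCommGroup G] (f : C(W, Z)) :
    singularComplex W G ⟶ singularComplex Z G :=
  SSet.chainComplexMap (TopCat.toSSet.map (TopCat.ofHom f)) (AddCommGrpCat.of G)

lemma toComplex_chainMap (f : C(W, Z)) (n : ℕ) (c : Chain W G n) :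
    toComplex Z G n (chainMap f n c) = (singularComplexMap G f).f n (toComplex W G n c) := by
  have : (toComplex Z G n).comp (chainMap f n) =
      (AddCommGrpCat.Hom.hom ((singularComplexMap G f).f n)).comp (toComplex W G n) := by
    refine Finsupp.addHom_ext fun σ g => ?_
    obtain ⟨x, rfl⟩ := ((TopCat.of W).toSSetObjEquiv (.op ⦋n⦌)).surjective σ
    rw [AddMonoidHom.comp_apply, AddMonoidHom.comp_apply, toComplex_single]
    have h := congr($(SSet.ι_chainComplexMap_f _ _ (TopCat.toSSet.map (TopCat.ofHom f))
      (AddCommGrpCat.of G) x) g)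
    refine Eq.trans ?_ h.symm
    refine Eq.trans ?_
      (toComplex_single ((TopCat.toSSet.map (TopCat.ofHom f)).app (.op ⦋n⦌) x) g)
    change toComplex Z G n (Finsupp.mapDomain _ _) = _
    rw [Finsupp.mapDomain_single]
    rfl
  exact DFunLike.congr_fun this c

lemma chainMap_injective {f : C(W, Z)} (hf : Function.Injective f) (n : ℕ) :
    Function.Injective (chainMap (G := G) f n) :=
  Finsupp.mapDomain_injective fun σ τ h => by
    ext t
    exact hf (DFunLike.congr_fun h t)

lemma chainMap_bdry (f : C(W, Z)) {n : ℕ} (c : Chain W G (n + 1)) :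
    chainMap f n (bdry c) = bdry (chainMap f (n + 1) c) := by
  apply (toComplex_bijective n).1
  rw [toComplex_chainMap, toComplex_bdry, toComplex_bdry, toComplex_chainMap, map_d]

lemma chainMap_mem (f : C(W, Z)) {n : ℕ} (c : Chain W G n) {Q : Set Z} (hQ : ∀ w, f w ∈ Q) :
    chainMap f n c ∈ chainsIn G n Q := by
  induction c using Finsupp.induction_linear with
  | zero => rw [map_zero]; exact zero_mem _
  | add a b ha hb => rw [map_add]; exact add_mem ha hb
  | single σ g =>
    change Finsupp.mapDomain _ _ ∈ _
    rw [Finsupp.mapDomain_single]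
    exact single_mem_chainsIn g fun t => hQ _

/-- The inclusion of a subspace. -/
def subspaceIncl (Q : Set Z) : C(Q, Z) := ⟨Subtype.val, continuous_subtype_val⟩

lemma exists_chainMap_eq {Q : Set Z} {n : ℕ} {c : Chain Z G n} (hc : c ∈ chainsIn G n Q) :
    ∃ c' : Chain Q G n, chainMap (subspaceIncl Q) n c' = c := by
  refine chainsIn_map (AddMonoidHom.range (chainMap (G := G) (subspaceIncl Q) n))
    (AddMonoidHom.id _) (fun σ g h => ?_) hc
  refine ⟨Finsupp.single ⟨fun t => ⟨σ t, h t⟩, by fun_prop⟩ g, ?_⟩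
  change Finsupp.mapDomain _ _ = _
  rw [Finsupp.mapDomain_single]
  rfl

lemma chainMap_comp {V : Type u} [TopologicalSpace V] (f : C(W, Z)) (g : C(V, W)) {n : ℕ}
    (c : Chain V G n) : chainMap (f.comp g) n c = chainMap f n (chainMap g n c) := by
  change Finsupp.mapDomain _ _ = Finsupp.mapDomain _ (Finsupp.mapDomain _ _)
  rw [← Finsupp.mapDomain_comp]
  rfl

lemma isCycle_of_toComplex : ∀ {n : ℕ} {c : Chain Z G n} {z : (singularComplex Z G).cycles n},
    toComplex Z G n c = (singularComplex Z G).iCycles n z → IsCycle c := by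
  intro n c z h
  rcases n with _ | n
  · trivial
  · change bdry c = 0
    apply (toComplex_bijective n).1
    rw [toComplex_bdry, h, d_iCycles, map_zero]

lemma IsCycle.chainMap (f : C(W, Z)) : ∀ {n : ℕ} {c : Chain W G n}, IsCycle c →
    IsCycle (chainMap f n c) := by
  intro n c h
  rcases n with _ | n
  · trivial
  · change bdry c = 0 at h
    change bdry _ = 0
    rw [← chainMap_bdry, h, map_zero]

/-- The inclusion of a subspace in a larger one. -/
def subspaceInclOfLE {Q R : Set Z} (h : Q ⊆ R) : C(Q, R) := ⟨Set.inclusion h, continuous_inclusion h⟩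

lemma exists_bdry_of_singularHomologyMap_eq_zero (f : C(W, Z)) {k : ℕ} {a : Chain W G k}
    {z : (singularComplex W G).cycles k} (hz : toComplex W G k a = (singularComplex W G).iCycles k z)
    (h : singularHomologyMap G k f ((singularComplex W G).homologyπ k z) = 0) :
    ∃ b : Chain Z G (k + 1), bdry b = chainMap f k a := by
  have h' : (singularComplex Z G).homologyπ k
      (HomologicalComplex.cyclesMap (singularComplexMap G f) k z) = 0 := by
    rw [← homologyMap_homologyπ]
    exact h
  obtain ⟨b, hb⟩ := (homologyπ_eq_zero_iff _ _ _).1 h'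
  obtain ⟨b, rfl⟩ := (toComplex_bijective (k + 1)).2 b
  refine ⟨b, (toComplex_bijective k).1 ?_⟩
  rw [toComplex_bdry, hb, iCycles_cyclesMap, ← hz, toComplex_chainMap]

/-- The Mayer–Vietoris argument for singular homology. -/
theorem eq_zero_of_cover {O P : Set Z} (hO : IsOpen O) (hP : IsOpen P) (hOP : O ∪ P = univ)
    {k : ℕ}
    (hsurj : Function.Surjective (singularHomologyMap G (k + 1) (subspaceIncl (Z := Z) P)))
    (x : (singularComplex (O ∩ P : Set Z) G).homology k)
    (hxO : singularHomologyMap G k (subspaceInclOfLE (inter_subset_left : O ∩ P ⊆ O)) x = 0)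
    (hxP : singularHomologyMap G k (subspaceInclOfLE (inter_subset_right : O ∩ P ⊆ P)) x = 0) :
    x = 0 := by
  obtain ⟨z, rfl⟩ := exists_homologyπ_eq _ _ x
  obtain ⟨a, ha⟩ := (toComplex_bijective k).2 ((singularComplex (O ∩ P : Set Z) G).iCycles k z)
  obtain ⟨b, hb⟩ := exists_bdry_of_singularHomologyMap_eq_zero _ ha hxO
  obtain ⟨c, hc⟩ := exists_bdry_of_singularHomologyMap_eq_zero _ ha hxP
  set a' := chainMap (subspaceIncl (O ∩ P)) k a with ha'
  set b' := chainMap (subspaceIncl O) (k + 1) b with hb'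
  set c' := chainMap (subspaceIncl P) (k + 1) c with hc'
  have hba : bdry b' = a' := by rw [hb', ← chainMap_bdry, hb, ← chainMap_comp]; rfl
  have hca : bdry c' = a' := by rw [hc', ← chainMap_bdry, hc, ← chainMap_comp]; rfl
  obtain ⟨w, hw⟩ := exists_iCycles_eq (singularComplex Z G) k (toComplex Z G (k + 1) (b' - c')) (by
    rw [← toComplex_bdry, map_sub, hba, hca, sub_self, map_zero])
  -- The cycle b' - c' in Z is homologous to a cycle q from P. Replacing c' by c' + q keeps it in P
  -- with the same boundary and makes the difference from b' a boundary.
  obtain ⟨p, hp⟩ := hsurj ((singularComplex Z G).homologyπ (k + 1) w)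
  obtain ⟨p, rfl⟩ := exists_homologyπ_eq (singularComplex P G) _ p
  obtain ⟨q, hq⟩ := (toComplex_bijective (k + 1)).2 ((singularComplex P G).iCycles (k + 1) p)
  have hp' : (singularComplex Z G).homologyπ (k + 1) (w -
      HomologicalComplex.cyclesMap (singularComplexMap G (subspaceIncl P)) (k + 1) p) = 0 := by
    rw [map_sub, ← hp, ← homologyMap_homologyπ]
    exact sub_self _
  obtain ⟨e, he⟩ := (homologyπ_eq_zero_iff _ _ _).1 hp'
  obtain ⟨e, rfl⟩ := (toComplex_bijective (k + 2)).2 e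
  have hq0 : bdry q = 0 := isCycle_of_toComplex (n := k + 1) hq
  have he' : bdry e = b' - (c' + chainMap (subspaceIncl P) (k + 1) q) := by
    apply (toComplex_bijective (k + 1)).1
    rw [toComplex_bdry, he, map_sub, hw, iCycles_cyclesMap, ← hq, ← toComplex_chainMap, ← map_sub,
      sub_sub]
  obtain ⟨r, hr, hra⟩ := exists_bdry_eq_of_cover hO hP hOP (a := a')
    (chainMap_mem _ _ fun w => w.2) (IsCycle.chainMap _ (isCycle_of_toComplex ha))
    (chainMap_mem _ _ fun w => w.2)
    (add_mem (chainMap_mem _ c fun w => w.2) (chainMap_mem _ q fun w => w.2)) hba he'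
  obtain ⟨r, rfl⟩ := exists_chainMap_eq hr
  rw [homologyπ_eq_zero_iff]
  refine ⟨toComplex _ G (k + 1) r, ?_⟩
  rw [← toComplex_bdry, ← ha]
  congr 1
  apply chainMap_injective (f := subspaceIncl (O ∩ P)) Subtype.val_injective
  rw [chainMap_bdry, hra]

end Comparison

/-! ### Equality in homology from homotopies in two covering sets. -/

section HomotopyCriterion

open CategoryTheory AlgebraicTopology

variable {S T R : Type u} [TopologicalSpace S] [TopologicalSpace T] [TopologicalSpace R]

lemma singularHomologyMap_congr (G : Type u) [AddCommGroup G] (k : ℕ) {f g : C(S, T)}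
    (h : f.Homotopic g) : singularHomologyMap G k f = singularHomologyMap G k g :=
  TopCat.Homotopy.congr_homologyMap_singularChainComplexFunctor
    (f := TopCat.ofHom f) (g := TopCat.ofHom g) h.some _ k

lemma singularHomologyMap_comp (G : Type u) [AddCommGroup G] (k : ℕ) (g : C(T, R)) (f : C(S, T)) :
    singularHomologyMap G k (g.comp f) = singularHomologyMap G k f ≫ singularHomologyMap G k g := by
  rw [singularHomologyMap, TopCat.ofHom_comp, Functor.map_comp]
  rfl

lemma singularHomologyMap_id (G : Type u) [AddCommGroup G] (k : ℕ) :
    singularHomologyMap G k (ContinuousMap.id S) = 𝟙 _ :=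
  CategoryTheory.Functor.map_id _ _

/-- Two maps to the intersection of two open sets covering a space that deforms into the second one
agree in homology if they are homotopic in both open sets. -/
theorem singularHomologyMap_eq_of_cover {O P : Set T} (hO : IsOpen O) (hP : IsOpen P)
    (hOP : O ∪ P = univ) (r : C(T, P))
    (hr : ((subspaceIncl P).comp r).Homotopic (ContinuousMap.id T))
    (f g : C(S, (O ∩ P : Set T)))
    (hfgO : ((subspaceInclOfLE (inter_subset_left : O ∩ P ⊆ O)).comp f).Homotopic
      ((subspaceInclOfLE (inter_subset_left : O ∩ P ⊆ O)).comp g))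
    (hfgP : ((subspaceInclOfLE (inter_subset_right : O ∩ P ⊆ P)).comp f).Homotopic
      ((subspaceInclOfLE (inter_subset_right : O ∩ P ⊆ P)).comp g))
    (G : Type u) [AddCommGroup G] (k : ℕ) :
    singularHomologyMap G k f = singularHomologyMap G k g := by
  ext x
  rw [← sub_eq_zero]
  -- The inclusion of P has the right homotopy inverse r, so it is onto in homology.
  refine eq_zero_of_cover hO hP hOP (fun y => ⟨singularHomologyMap G (k + 1) r y, ?_⟩) _ ?_ ?_
  · have h := singularHomologyMap_congr G (k + 1) hr
    rw [singularHomologyMap_comp, singularHomologyMap_id] at h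
    exact congr($h y)
  · have h := singularHomologyMap_congr G k hfgO
    rw [singularHomologyMap_comp, singularHomologyMap_comp] at h
    refine (map_sub _ _ _).trans (sub_eq_zero.2 ?_)
    exact congr($h x)
  · have h := singularHomologyMap_congr G k hfgP
    rw [singularHomologyMap_comp, singularHomologyMap_comp] at h
    refine (map_sub _ _ _).trans (sub_eq_zero.2 ?_)
    exact congr($h x)

end HomotopyCriterion

end SingularSubdivision

/-! ### Uniform local estimates for integral curves of a continuous field. -/

namespace VectorFieldFlow

variable {n : ℕ} {M : Type*} [TopologicalSpace M] [ChartedSpace (EuclideanSpace ℝ (Fin n)) M]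
  [IsManifold (𝓡 n) ∞ M]

section Estimates

/-- The coordinate expression of a vector field in the preferred chart at `p`. -/
def coordField (X : ∀ x : M, TangentSpace (𝓡 n) x) (p y : M) : EuclideanSpace ℝ (Fin n) :=
  tangentCoordChange (𝓡 n) y p y (X y)

/-- Continuity of a vector field, expressed in charts. -/
def CoordContinuous (X : ∀ x : M, TangentSpace (𝓡 n) x) : Prop :=
  ∀ p : M, ContinuousOn (coordField X p) (extChartAt (𝓡 n) p).source

variable {X : ∀ x : M, TangentSpace (𝓡 n) x}

lemma coordField_self (X : ∀ x : M, TangentSpace (𝓡 n) x) (p : M) : coordField X p p = X p :=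
  tangentCoordChange_self (mem_extChartAt_source p)

lemma coordContinuous_of_isC0VectorField (hX : IsC0VectorField X) : CoordContinuous X := by
  intro p y hy
  have h2 := (trivializationAt (EuclideanSpace ℝ (Fin n)) (TangentSpace (𝓡 n)) p).continuousOn
  have hmem : (⟨y, X y⟩ : TangentBundle (𝓡 n) M) ∈
      (trivializationAt (EuclideanSpace ℝ (Fin n)) (TangentSpace (𝓡 n)) p).source := by
    rw [Bundle.Trivialization.mem_source]
    simpa using hy
  have h3 := (h2.continuousAt ((trivializationAt (EuclideanSpace ℝ (Fin n)) (TangentSpace (𝓡 n)) p).open_source.mem_nhds hmem)).comp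
    (f := fun x : M => (⟨x, X x⟩ : TangentBundle (𝓡 n) M)) hX.continuousAt
  exact (continuous_snd.continuousAt.comp h3).continuousWithinAt

lemma CoordContinuous.neg (hX : CoordContinuous X) : CoordContinuous ((-1 : ℝ) • X) := by
  intro p
  have : coordField ((-1 : ℝ) • X) p = fun y => (-1 : ℝ) • coordField X p y := by
    funext y
    exact map_smul (tangentCoordChange (𝓡 n) y p y) (-1 : ℝ) (X y)
  rw [this]
  exact (continuousOn_const (c := (-1 : ℝ))).smul (hX p)

lemma hasDerivAt_chart_comp {J : Set ℝ} (hJ : IsOpen J) {γ : ℝ → M}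
    (hγ : IsMIntegralCurveOn γ X J) {t : ℝ} (ht : t ∈ J) {p : M}
    (hsrc : γ t ∈ (extChartAt (𝓡 n) p).source) :
    HasDerivAt (extChartAt (𝓡 n) p ∘ γ) (coordField X p (γ t)) t := by
  have hsrc' : γ t ∈ (chartAt (EuclideanSpace ℝ (Fin n)) p).source := by simpa using hsrc
  have h := HasMFDerivAt.comp t (hasMFDerivAt_extChartAt (I := 𝓡 n) hsrc')
    ((hγ t ht).hasMFDerivAt (hJ.mem_nhds ht))
  have h2 : HasFDerivAt (extChartAt (𝓡 n) p ∘ γ) (ContinuousLinearMap.comp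
    (tangentCoordChange (𝓡 n) (γ t) p (γ t))
    ((1 : ℝ →L[ℝ] ℝ).smulRight (X (γ t) : EuclideanSpace ℝ (Fin n)))) t := by
    have h3 := h.hasFDerivAt
    rw [mfderiv_chartAt_eq_tangentCoordChange hsrc'] at h3
    exact h3
  have h3 := h2.hasDerivAt
  rw [ContinuousLinearMap.comp_apply] at h3
  have h4 : ((1 : ℝ →L[ℝ] ℝ).smulRight (X (γ t) : EuclideanSpace ℝ (Fin n))) 1 = X (γ t) :=
    one_smul ℝ (X (γ t))
  exact h3.congr_deriv (congrArg (tangentCoordChange (𝓡 n) (γ t) p (γ t)) h4)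

lemma hasMFDerivAt_of_hasDerivAt_chart {γ : ℝ → M} {t : ℝ} (hc : ContinuousAt γ t)
    (h : HasDerivAt (extChartAt (𝓡 n) (γ t) ∘ γ) (coordField X (γ t) (γ t)) t) :
    HasMFDerivAt 𝓘(ℝ, ℝ) (𝓡 n) γ t ((1 : ℝ →L[ℝ] ℝ).smulRight (X (γ t))) := by
  have h2 : HasFDerivAt (extChartAt (𝓡 n) (γ t) ∘ γ)
      ((1 : ℝ →L[ℝ] ℝ).smulRight (coordField X (γ t) (γ t))) t := by
    have h3 := h.hasFDerivAt
    have h4 : (1 : ℝ →L[ℝ] ℝ).smulRight (coordField X (γ t) (γ t)) =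
        ContinuousLinearMap.toSpanSingleton ℝ (coordField X (γ t) (γ t)) := by
      ext
      simp
    exact h4 ▸ h3
  rw [coordField_self] at h2
  exact ⟨hc, h2.hasFDerivWithinAt⟩

/-- Continuity of γ is not assumed: it follows from differentiability in the chart. This is the form
in which a pointwise limit of integral curves is recognized as an integral curve. -/
lemma hasMFDerivAt_of_estimate {γ : ℝ → M} {t : ℝ}
    (h : ∀ ε > 0, ∀ᶠ s in 𝓝 t, γ s ∈ (extChartAt (𝓡 n) (γ t)).source ∧
      ‖extChartAt (𝓡 n) (γ t) (γ s) - extChartAt (𝓡 n) (γ t) (γ t) -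
        (s - t) • coordField X (γ t) (γ t)‖ ≤ ε * |s - t|) :
    HasMFDerivAt 𝓘(ℝ, ℝ) (𝓡 n) γ t ((1 : ℝ →L[ℝ] ℝ).smulRight (X (γ t))) := by
  have hd : HasDerivAt (extChartAt (𝓡 n) (γ t) ∘ γ) (coordField X (γ t) (γ t)) t := by
    rw [hasDerivAt_iff_isLittleO, Asymptotics.isLittleO_iff]
    intro ε hε
    filter_upwards [h ε hε] with s hs
    exact hs.2
  refine hasMFDerivAt_of_hasDerivAt_chart ?_ hd
  have h1 : ContinuousAt ((extChartAt (𝓡 n) (γ t)).symm ∘ (extChartAt (𝓡 n) (γ t) ∘ γ)) t :=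
    ContinuousAt.comp (continuousAt_extChartAt_symm (I := 𝓡 n) (γ t)) hd.continuousAt
  refine h1.congr ?_
  filter_upwards [h 1 one_pos] with s hs
  exact (extChartAt (𝓡 n) (γ t)).left_inv hs.1

variable [T2Space M]

/-- The coordinate speed near p is bounded by L, so a curve starting close to p needs a definite
time to leave a small chart ball. The bound applies only while the curve is in the ball, hence a
continuity induction along the time interval. -/
lemma forward_confinement (hX : CoordContinuous X) (p : M) {W : Set M} (hW : W ∈ 𝓝 p) :
    ∃ N ∈ 𝓝 p, ∃ δ > 0, ∀ (J : Set ℝ) (γ : ℝ → M), IsOpen J → J.OrdConnected →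
      IsMIntegralCurveOn γ X J → ∀ s ∈ J, ∀ t ∈ J, γ s ∈ N → s ≤ t → t ≤ s + δ → γ t ∈ W := by
  set e := extChartAt (𝓡 n) p with he
  set L : ℝ := ‖coordField X p p‖ + 1 with hL
  have hLpos : 0 < L := by positivity
  have hsrc : e.source ∈ 𝓝 p := extChartAt_source_mem_nhds p
  have hbd : {y | ‖coordField X p y‖ < L} ∈ 𝓝 p :=
    ((hX p).continuousAt hsrc).norm.eventually (gt_mem_nhds (by rw [hL]; linarith))
  have hpre : e.symm ⁻¹' (W ∩ {y | ‖coordField X p y‖ < L}) ∈ 𝓝 (e p) := by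
    apply (continuousAt_extChartAt_symm (I := 𝓡 n) p).preimage_mem_nhds
    rw [← he, e.left_inv (mem_extChartAt_source p)]
    exact inter_mem hW hbd
  obtain ⟨r, hr, hball⟩ := Metric.nhds_basis_closedBall.mem_iff.1
    (inter_mem hpre (extChartAt_target_mem_nhds (I := 𝓡 n) p))
  have hsymm : ContinuousOn e.symm (Metric.closedBall (e p) r) :=
    (continuousOn_extChartAt_symm (I := 𝓡 n) p).mono fun z hz => (hball hz).2
  set K : Set M := e.symm '' Metric.closedBall (e p) r with hK
  have hKc : IsClosed K := ((isCompact_closedBall _ _).image_of_continuousOn hsymm).isClosed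
  have hKsrc : K ⊆ e.source := by
    rintro _ ⟨z, hz, rfl⟩
    exact e.map_target (hball hz).2
  have hKmem : ∀ y ∈ e.source, e y ∈ Metric.closedBall (e p) r → y ∈ K := fun y hy hy' =>
    ⟨e y, hy', e.left_inv hy⟩
  have hKW : ∀ y ∈ K, y ∈ W ∧ ‖coordField X p y‖ < L := by
    rintro _ ⟨z, hz, rfl⟩
    exact (hball hz).1
  have hcont : ContinuousOn e e.source := continuousOn_extChartAt p
  have hopen : ∀ ρ : ℝ, IsOpen (e.source ∩ e ⁻¹' Metric.ball (e p) ρ) := fun ρ =>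
    hcont.isOpen_inter_preimage (isOpen_extChartAt_source p) Metric.isOpen_ball
  -- Starting within r / 2 and moving at most L * (r / (4 * L)) = r / 4 leaves the curve strictly
  -- inside the ball of radius r, with room to continue.
  refine ⟨e.source ∩ e ⁻¹' Metric.ball (e p) (r / 2), (hopen _).mem_nhds
    ⟨mem_extChartAt_source p, Metric.mem_ball_self (half_pos hr)⟩, r / (4 * L), by positivity, ?_⟩
  intro J γ hJo hJc hγ s hs t ht hsN hst htδ
  have hIcc : Icc s t ⊆ J := hJc.out hs ht
  have hγc : ContinuousOn γ (Icc s t) := hγ.continuousOn.mono hIcc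
  set S : Set ℝ := {u | γ u ∈ K ∧ ‖e (γ u) - e (γ s)‖ ≤ L * (u - s)} with hS
  have hSclosed : IsClosed (S ∩ Icc s t) := by
    have h1 : IsClosed (Icc s t ∩ γ ⁻¹' K) := hγc.preimage_isClosed_of_isClosed isClosed_Icc hKc
    have h2 : ContinuousOn (fun u => ‖e (γ u) - e (γ s)‖ - L * (u - s)) (Icc s t ∩ γ ⁻¹' K) := by
      have h3 : ContinuousOn (fun u => e (γ u)) (Icc s t ∩ γ ⁻¹' K) :=
        (hcont.mono hKsrc).comp (hγc.mono inter_subset_left) fun u hu => hu.2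
      exact (h3.sub continuousOn_const).norm.sub (by fun_prop)
    have h4 := h2.preimage_isClosed_of_isClosed h1 (isClosed_Iic (a := (0 : ℝ)))
    convert h4 using 1
    ext u
    simp only [hS, mem_inter_iff, mem_ofPred_eq, mem_preimage, mem_Iic, sub_nonpos]
    tauto
  have hsub : Icc s t ⊆ S := by
    refine hSclosed.Icc_subset_of_forall_mem_nhdsWithin ⟨hKmem _ hsN.1 ?_, by simp⟩ ?_
    · exact Metric.ball_subset_closedBall (Metric.ball_subset_ball (half_le_self hr.le) hsN.2)
    · rintro x ⟨⟨hxK, hxL⟩, hxs, hxt⟩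
      have hxJ : x ∈ J := hIcc ⟨hxs, hxt.le⟩
      have hxball : γ x ∈ e.source ∩ e ⁻¹' Metric.ball (e p) r := by
        refine ⟨hKsrc hxK, ?_⟩
        have h1 : dist (e (γ s)) (e p) < r / 2 := hsN.2
        have h2 : dist (e (γ x)) (e (γ s)) ≤ r / 4 := by
          rw [dist_eq_norm]
          calc _ ≤ L * (x - s) := hxL
            _ ≤ L * (r / (4 * L)) := by gcongr; linarith
            _ = r / 4 := by field_simp
        change dist (e (γ x)) (e p) < r
        linarith [dist_triangle (e (γ x)) (e (γ s)) (e p)]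
      have hnb : γ ⁻¹' (e.source ∩ e ⁻¹' Metric.ball (e p) r) ∩ J ∈ 𝓝 x :=
        inter_mem ((hγ.continuousOn.continuousAt (hJo.mem_nhds hxJ)).preimage_mem_nhds
          ((hopen r).mem_nhds hxball)) (hJo.mem_nhds hxJ)
      obtain ⟨η, hη, hηb⟩ := Metric.mem_nhds_iff.1 hnb
      refine mem_nhdsWithin.2 ⟨Metric.ball x η, Metric.isOpen_ball, Metric.mem_ball_self hη, ?_⟩
      rintro u ⟨huη, hxu : x < u⟩
      have hseg : ∀ v ∈ Icc x u, v ∈ γ ⁻¹' (e.source ∩ e ⁻¹' Metric.ball (e p) r) ∩ J :=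
        fun v hv => hηb (by
          rw [Metric.mem_ball, Real.dist_eq, abs_lt] at huη ⊢
          constructor <;> linarith [hv.1, hv.2])
      have hsegK : ∀ v ∈ Icc x u, γ v ∈ K := fun v hv =>
        hKmem _ (hseg v hv).1.1 (Metric.ball_subset_closedBall (hseg v hv).1.2)
      refine ⟨hsegK u ⟨hxu.le, le_rfl⟩, ?_⟩
      have h5 := norm_image_sub_le_of_norm_deriv_le_segment' (f := e ∘ γ)
        (f' := fun v => coordField X p (γ v)) (C := L)
        (fun v hv => (hasDerivAt_chart_comp hJo hγ (hseg v hv).2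
          (hseg v hv).1.1).hasDerivWithinAt)
        (fun v hv => (hKW _ (hsegK v (Ico_subset_Icc_self hv))).2.le) u ⟨hxu.le, le_rfl⟩
      calc ‖e (γ u) - e (γ s)‖ ≤ ‖e (γ u) - e (γ x)‖ + ‖e (γ x) - e (γ s)‖ :=
            norm_sub_le_norm_sub_add_norm_sub _ _ _
        _ ≤ L * (u - x) + L * (x - s) := add_le_add h5 hxL
        _ = L * (u - s) := by ring
  exact (hKW _ (hsub ⟨hst, le_rfl⟩).1).1

/-- Backward time is forward time for the reversed curve, an integral curve of -X. -/
lemma confinement (hX : CoordContinuous X) (p : M) {W : Set M} (hW : W ∈ 𝓝 p) :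
    ∃ N ∈ 𝓝 p, ∃ δ > 0, ∀ (J : Set ℝ) (γ : ℝ → M), IsOpen J → J.OrdConnected →
      IsMIntegralCurveOn γ X J → ∀ s ∈ J, ∀ t ∈ J, γ s ∈ N → |t - s| ≤ δ → γ t ∈ W := by
  obtain ⟨N, hN, δ, hδ, h⟩ := forward_confinement hX p hW
  obtain ⟨N', hN', δ', hδ', h'⟩ := forward_confinement hX.neg p hW
  refine ⟨N ∩ N', inter_mem hN hN', min δ δ', lt_min hδ hδ', ?_⟩
  intro J γ hJo hJc hγ s hs t ht hsN hst
  rw [abs_le] at hst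
  rcases le_total s t with hle | hle
  · exact h J γ hJo hJc hγ s hs t ht hsN.1 hle (by linarith [min_le_left δ δ'])
  · have := h' {u | u * (-1) ∈ J} (γ ∘ fun u => u * (-1)) (hJo.preimage (by fun_prop))
      ⟨fun a ha b hb c hc => hJc.out hb ha ⟨by linarith [hc.2], by linarith [hc.1]⟩⟩
      (hγ.comp_mul (-1)) (-s) (by simpa using hs) (-t) (by simpa using ht) (by simpa using hsN.2)
      (by linarith) (by linarith [min_le_right δ δ'])
    simpa using this

/-- Mean value inequality for the coordinate curve minus its linear approximation, whose derivative
is smaller than ε where `confinement` applies. N and δ do not depend on the curve, so the estimate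
survives limits of curves. -/
lemma displacement (hX : CoordContinuous X) (p : M) {W : Set M} (hW : W ∈ 𝓝 p) {ε : ℝ}
    (hε : 0 < ε) :
    ∃ N ∈ 𝓝 p, ∃ δ > 0, ∀ (J : Set ℝ) (γ : ℝ → M), IsOpen J → J.OrdConnected →
      IsMIntegralCurveOn γ X J → ∀ s ∈ J, ∀ t ∈ J, γ s ∈ N → |t - s| ≤ δ →
        γ t ∈ W ∧ ‖extChartAt (𝓡 n) p (γ t) - extChartAt (𝓡 n) p (γ s) -
          (t - s) • coordField X p p‖ ≤ ε * |t - s| := by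
  have hsrc : (extChartAt (𝓡 n) p).source ∈ 𝓝 p := extChartAt_source_mem_nhds p
  have hF : {y | ‖coordField X p y - coordField X p p‖ < ε} ∈ 𝓝 p := by
    have h1 : ContinuousAt (fun y => ‖coordField X p y - coordField X p p‖) p :=
      (((hX p).continuousAt hsrc).sub continuousAt_const).norm
    refine h1.eventually (gt_mem_nhds ?_)
    simp only [sub_self, norm_zero]
    exact hε
  obtain ⟨N, hN, δ, hδ, h⟩ := confinement hX p (inter_mem hW (inter_mem hsrc hF))
  refine ⟨N, hN, δ, hδ, fun J γ hJo hJc hγ s hs t ht hsN hst =>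
    ⟨(h J γ hJo hJc hγ s hs t ht hsN hst).1, ?_⟩⟩
  have hsubJ : uIcc s t ⊆ J := hJc.uIcc_subset hs ht
  have hin : ∀ u ∈ uIcc s t, γ u ∈ _ := fun u hu =>
    h J γ hJo hJc hγ s hs u (hsubJ hu) hsN ((abs_sub_left_of_mem_uIcc hu).trans hst)
  have hder : ∀ u ∈ uIcc s t, HasDerivWithinAt
      (fun v => extChartAt (𝓡 n) p (γ v) - v • coordField X p p)
      (coordField X p (γ u) - coordField X p p) (uIcc s t) u := fun u hu => by
    have h1 := hasDerivAt_chart_comp hJo hγ (hsubJ hu) (hin u hu).2.1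
    have h2 := (hasDerivAt_id u).smul_const (coordField X p p)
    rw [one_smul] at h2
    exact (h1.sub h2).hasDerivWithinAt
  have h3 := (convex_uIcc s t).norm_image_sub_le_of_norm_hasDerivWithin_le hder
    (fun u hu => (hin u hu).2.2.le) left_mem_uIcc right_mem_uIcc
  rw [Real.norm_eq_abs] at h3
  refine le_trans (le_of_eq ?_) h3
  congr 1
  rw [sub_smul]
  abel

end Estimates

end VectorFieldFlow

/-! ### Maximal integral curves, the forward flow and its continuity. -/

namespace VectorFieldFlow

variable {n : ℕ} {M : Type*} [TopologicalSpace M] [ChartedSpace (EuclideanSpace ℝ (Fin n)) M]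
  [IsManifold (𝓡 n) ∞ M] {X : ∀ x : M, TangentSpace (𝓡 n) x}

section Maximal

lemma isMIntegralCurveOn_of_local {J : Set ℝ} {γ : ℝ → M}
    (h : ∀ t ∈ J, ∃ γ' : ℝ → M, γ =ᶠ[𝓝 t] γ' ∧
      HasMFDerivAt 𝓘(ℝ, ℝ) (𝓡 n) γ' t ((1 : ℝ →L[ℝ] ℝ).smulRight (X (γ' t)))) :
    IsMIntegralCurveOn γ X J := by
  intro t ht
  obtain ⟨γ', hγ', hd⟩ := h t ht
  have h1 := hd.congr_of_eventuallyEq hγ'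
  have h2 : γ t = γ' t := hγ'.eq_of_nhds
  rw [← h2] at h1
  exact h1.hasMFDerivWithinAt

/-- Every integral curve extends to a maximal one. -/
lemma exists_isMaximalIntegralCurve {x : M} {J : Set ℝ} {γ : ℝ → M}
    (h : IsIntegralCurveFrom X x J γ) :
    ∃ (J' : Set ℝ) (γ' : ℝ → M), IsMaximalIntegralCurve X x J' γ' ∧ J ⊆ J' ∧ EqOn γ γ' J := by
  -- Zorn's lemma for extensions of γ. The relation is only a preorder, as values outside the
  -- domains are ignored; transitivity suffices.
  let α := {p : Set ℝ × (ℝ → M) // IsIntegralCurveFrom X x p.1 p.2 ∧ J ⊆ p.1 ∧ EqOn γ p.2 J}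
  let r : α → α → Prop := fun a b => a.1.1 ⊆ b.1.1 ∧ EqOn a.1.2 b.1.2 a.1.1
  have htrans : ∀ {a b c : α}, r a b → r b c → r a c := fun hab hbc =>
    ⟨hab.1.trans hbc.1, fun t ht => (hab.2 ht).trans (hbc.2 (hab.1 ht))⟩
  have hub : ∀ c : Set α, IsChain r c → ∃ ub, ∀ a ∈ c, r a ub := by
    intro c hc
    rcases c.eq_empty_or_nonempty with rfl | ⟨a₀, ha₀⟩
    · exact ⟨⟨(J, γ), h, subset_rfl, fun _ _ => rfl⟩, by simp⟩
    classical
    let J' : Set ℝ := ⋃₀ ((fun a : α => a.1.1) '' c)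
    let γ' : ℝ → M := fun t => if h : ∃ a ∈ c, t ∈ a.1.1 then h.choose.1.2 t else x
    have heq : ∀ a ∈ c, EqOn a.1.2 γ' a.1.1 := by
      intro a ha t ht
      have hex : ∃ a ∈ c, t ∈ a.1.1 := ⟨a, ha, ht⟩
      have h1 : γ' t = hex.choose.1.2 t := dif_pos hex
      rw [h1]
      obtain ⟨hb, hbt⟩ := hex.choose_spec
      by_cases hne : a = hex.choose
      · rw [← hne]
      rcases hc ha hb hne with h2 | h2
      · exact h2.2 ht
      · exact (h2.2 hbt).symm
    have hsub : ∀ a ∈ c, a.1.1 ⊆ J' := fun a ha => subset_sUnion_of_mem ⟨a, ha, rfl⟩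
    refine ⟨⟨(J', γ'), ⟨?_, ?_, ?_, ?_, ?_⟩, ?_, ?_⟩, fun a ha => ⟨hsub a ha, heq a ha⟩⟩
    · apply isOpen_sUnion
      rintro _ ⟨a, _, rfl⟩
      exact a.2.1.isOpen
    · rw [← isPreconnected_iff_ordConnected]
      apply isPreconnected_sUnion (0 : ℝ)
      · rintro _ ⟨a, _, rfl⟩
        exact a.2.1.zero_mem
      · rintro _ ⟨a, _, rfl⟩
        exact isPreconnected_iff_ordConnected.2 a.2.1.ordConnected
    · exact hsub a₀ ha₀ a₀.2.1.zero_mem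
    · exact (heq a₀ ha₀ a₀.2.1.zero_mem).symm.trans a₀.2.1.initial
    · refine isMIntegralCurveOn_of_local ?_
      rintro t ⟨_, ⟨a, ha, rfl⟩, ht⟩
      have hn := a.2.1.isOpen.mem_nhds ht
      refine ⟨a.1.2, ?_, (a.2.1.integral t ht).hasMFDerivAt hn⟩
      filter_upwards [hn] with s hs
      exact (heq a ha hs).symm
    · exact a₀.2.2.1.trans (hsub a₀ ha₀)
    · exact fun t ht => (a₀.2.2.2 ht).trans (heq a₀ ha₀ (a₀.2.2.1 ht))
  obtain ⟨m, hm⟩ := exists_maximal_of_chains_bounded hub htrans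
  refine ⟨m.1.1, m.1.2, ⟨m.2.1, fun J' γ' h' hJ hγ => ?_⟩, m.2.2.1, m.2.2.2⟩
  exact (hm ⟨(J', γ'), h', m.2.2.1.trans hJ,
    fun t ht => (m.2.2.2 ht).trans (hγ (m.2.2.1 ht))⟩ ⟨hJ, hγ⟩).1.antisymm hJ

variable (hu : UniquelyIntegrable X)

/-- The domain of the maximal integral curve through a point. -/
def flowDom (hu : UniquelyIntegrable X) (x : M) : Set ℝ := (hu x).1.choose

/-- The flow: `flow hu x t` is the position at time `t` of the maximal integral curve through
`x`. -/
def flow (hu : UniquelyIntegrable X) (x : M) : ℝ → M := (hu x).1.choose_spec.choose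

lemma flow_isMaximal (x : M) : IsMaximalIntegralCurve X x (flowDom hu x) (flow hu x) :=
  (hu x).1.choose_spec.choose_spec

lemma flow_zero (x : M) : flow hu x 0 = x := (flow_isMaximal hu x).initial

/-- Extending to a maximal curve first turns uniqueness of maximal curves into uniqueness of all
integral curves. -/
lemma flow_unique {x : M} {J : Set ℝ} {γ : ℝ → M} (h : IsIntegralCurveFrom X x J γ) :
    J ⊆ flowDom hu x ∧ EqOn γ (flow hu x) J := by
  obtain ⟨J', γ', hmax, hJ, heq⟩ := exists_isMaximalIntegralCurve h
  obtain ⟨h1, h2⟩ := (hu x).2 _ _ _ _ hmax (flow_isMaximal hu x)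
  exact ⟨h1 ▸ hJ, fun t ht => (heq ht).trans (h2 (hJ ht))⟩

/-- The time s may be negative, which allows following an orbit back to its start. -/
lemma flow_shift {x : M} {t : ℝ} (ht : t ∈ flowDom hu x) {s : ℝ} (hs : s + t ∈ flowDom hu x) :
    s ∈ flowDom hu (flow hu x t) ∧ flow hu (flow hu x t) s = flow hu x (s + t) := by
  have hmax := flow_isMaximal hu x
  have h : IsIntegralCurveFrom X (flow hu x t) {s | s + t ∈ flowDom hu x}
      (flow hu x ∘ fun s => s + t) := by
    refine ⟨hmax.isOpen.preimage (by fun_prop), ⟨fun a ha b hb c hc => ?_⟩, ?_, ?_,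
      hmax.integral.comp_add t⟩
    · exact hmax.ordConnected.out ha hb ⟨by linarith [hc.1], by linarith [hc.2]⟩
    · simpa using ht
    · simp
  exact ⟨(flow_unique hu h).1 hs, ((flow_unique hu h).2 hs).symm⟩

/-- The points whose maximal integral curve is defined for all positive time. -/
def forwardComplete (hu : UniquelyIntegrable X) : Set M := {x | Ici 0 ⊆ flowDom hu x}

lemma flow_add {x : M} (hx : x ∈ forwardComplete hu) {s t : ℝ} (hs : 0 ≤ s) (ht : 0 ≤ t) :
    flow hu (flow hu x t) s = flow hu x (s + t) :=
  (flow_shift hu (hx ht) (hx (add_nonneg hs ht))).2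

lemma flow_mem_forwardComplete {x : M} (hx : x ∈ forwardComplete hu) {t : ℝ} (ht : 0 ≤ t) :
    flow hu x t ∈ forwardComplete hu := fun _ hs =>
  (flow_shift hu (hx ht) (hx (add_nonneg (mem_Ici.1 hs) ht))).1

end Maximal

section Continuity

variable [T2Space M] (hu : UniquelyIntegrable X) (hX : CoordContinuous X)

include hX

/-- Without a Lipschitz condition, continuity comes from compactness and uniqueness. Along an
ultrafilter tending to x, the short orbits stay in a compact set and converge pointwise; the limit
inherits the displacement estimates, so it is an integral curve from x and coincides with the flow.
The time δ is uniform near p. -/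
lemma local_pointwise_continuity (p : M) :
    ∃ N ∈ 𝓝 p, ∃ δ > 0, ∀ x ∈ forwardComplete hu, x ∈ N → ∀ t, 0 ≤ t → t < δ →
      ContinuousWithinAt (fun y => flow hu y t) (forwardComplete hu) x := by
  have : LocallyCompactSpace M := ChartedSpace.locallyCompactSpace (EuclideanSpace ℝ (Fin n)) M
  obtain ⟨K, hK, hKp⟩ := exists_compact_mem_nhds p
  obtain ⟨N, hN, δ, hδ, hconf⟩ := confinement hX p hKp
  refine ⟨interior N, interior_mem_nhds.2 hN, δ, hδ, fun x hx hxN t₀ ht₀ htδ => ?_⟩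
  have hflow := fun y => flow_isMaximal hu y
  refine tendsto_iff_ultrafilter _ _ _ |>.2 fun g hg => ?_
  have hgD : ∀ᶠ y in (g : Filter M), y ∈ forwardComplete hu := hg self_mem_nhdsWithin
  have hgx : (g : Filter M) ≤ 𝓝 x := hg.trans nhdsWithin_le_nhds
  have hgN : ∀ᶠ y in (g : Filter M), y ∈ N := hgx (mem_interior_iff_mem_nhds.1 hxN)
  have hlim : ∀ u, 0 ≤ u ∧ u ≤ δ → ∃ q, Tendsto (fun y => flow hu y u) g (𝓝 q) := by
    intro u hu'
    have hmem : ∀ᶠ y in (g : Filter M), flow hu y u ∈ K := by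
      filter_upwards [hgD, hgN] with y hy hyN
      refine hconf _ _ (hflow y).isOpen (hflow y).ordConnected (hflow y).integral 0
        (hflow y).zero_mem u (hy hu'.1) ?_ ?_
      · rwa [flow_zero]
      · rw [sub_zero, abs_of_nonneg hu'.1]
        exact hu'.2
    obtain ⟨q, _, hq⟩ := hK.ultrafilter_le_nhds (g.map fun y => flow hu y u)
      (le_principal_iff.2 hmem)
    exact ⟨q, hq⟩
  have : Nonempty M := ⟨x⟩
  choose! η hη using hlim
  have hη0 : η 0 = x := by
    refine tendsto_nhds_unique (hη 0 ⟨le_rfl, hδ.le⟩) ?_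
    simp only [flow_zero]
    exact hgx
  -- Integral curves live on open intervals around 0, but the nearby orbits are controlled only
  -- forward, so negative times are filled in with the orbit of x.
  let ζ : ℝ → M := fun u => if u < 0 then flow hu x u else η u
  have hζ0 : ζ 0 = x := by simp [ζ, hη0]
  have hcurve : IsIntegralCurveFrom X x (flowDom hu x ∩ Iio δ) ζ := by
    refine ⟨(hflow x).isOpen.inter isOpen_Iio, (hflow x).ordConnected.inter ordConnected_Iio,
      ⟨(hflow x).zero_mem, hδ⟩, hζ0, ?_⟩
    rintro t ⟨htJ, htδ : t < δ⟩
    apply HasMFDerivAt.hasMFDerivWithinAt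
    by_cases ht : t < 0
    · have heq : ζ =ᶠ[𝓝 t] flow hu x := by
        filter_upwards [gt_mem_nhds ht] with u hu'
        exact if_pos hu'
      have h1 := ((hflow x).integral t htJ).hasMFDerivAt ((hflow x).isOpen.mem_nhds htJ)
      have h2 := h1.congr_of_eventuallyEq heq
      rwa [← heq.eq_of_nhds] at h2
    · have ht : 0 ≤ t := not_lt.1 ht
      have hζt : ζ t = η t := if_neg ht.not_gt
      refine hasMFDerivAt_of_estimate fun ε hε => ?_
      set q := ζ t with hq
      have hsrc : (extChartAt (𝓡 n) q).source ∈ 𝓝 q := extChartAt_source_mem_nhds q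
      -- W is compact, hence closed, so limits of points of W remain in the chart domain.
      obtain ⟨W, hW, hWsrc, hWc⟩ := local_compact_nhds hsrc
      obtain ⟨N', hN', δ', hδ', hdisp⟩ := displacement hX q hW hε
      have hgt : ∀ᶠ y in (g : Filter M), flow hu y t ∈ N' := by
        refine hη t ⟨ht, htδ.le⟩ ?_
        rw [← hζt]
        exact hN'
      have hright : ∀ u, 0 ≤ u → u < δ → |u - t| ≤ δ' → ζ u ∈ (extChartAt (𝓡 n) q).source ∧
          ‖extChartAt (𝓡 n) q (ζ u) - extChartAt (𝓡 n) q q - (u - t) • coordField X q q‖ ≤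
            ε * |u - t| := by
        intro u hu0 huδ hut
        have hζu : ζ u = η u := if_neg hu0.not_gt
        have hd : ∀ᶠ y in (g : Filter M), flow hu y u ∈ W ∧
            ‖extChartAt (𝓡 n) q (flow hu y u) - extChartAt (𝓡 n) q (flow hu y t) -
              (u - t) • coordField X q q‖ ≤ ε * |u - t| := by
          filter_upwards [hgD, hgt] with y hy hyt
          exact hdisp _ _ (hflow y).isOpen (hflow y).ordConnected (hflow y).integral t (hy ht) u
            (hy hu0) hyt hut
        have hlu := hη u ⟨hu0, huδ.le⟩
        have hmemW : η u ∈ W := hWc.isClosed.mem_of_tendsto hlu (hd.mono fun y hy => hy.1)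
        rw [hζu]
        refine ⟨hWsrc hmemW, ?_⟩
        have hc1 := (continuousAt_extChartAt' (I := 𝓡 n) (hWsrc hmemW)).tendsto.comp hlu
        have hc2 : Tendsto (fun y => extChartAt (𝓡 n) q (flow hu y t)) g
            (𝓝 (extChartAt (𝓡 n) q q)) := by
          have := hη t ⟨ht, htδ.le⟩
          rw [← hζt] at this
          exact (continuousAt_extChartAt (I := 𝓡 n) q).tendsto.comp this
        exact le_of_tendsto ((hc1.sub hc2).sub_const _).norm (hd.mono fun y hy => hy.2)
      have hnb : ∀ᶠ u in 𝓝 t, u < δ ∧ |u - t| ≤ δ' ∧ u ∈ flowDom hu x := by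
        refine (gt_mem_nhds htδ).and (Eventually.and ?_ ((hflow x).isOpen.mem_nhds htJ))
        filter_upwards [Metric.ball_mem_nhds t hδ'] with u hu'
        rw [Metric.mem_ball, Real.dist_eq] at hu'
        exact hu'.le
      -- At time 0 the right-hand estimate comes from the limit and the left-hand one from the orbit
      -- of x.
      rcases ht.eq_or_lt with h0 | h0
      · filter_upwards [hnb] with u hu'
        by_cases hu0 : 0 ≤ u
        · exact hright u hu0 hu'.1 hu'.2.1
        · have hqx : q = x := by rw [hq, ← h0, hζ0]
          have h1 := hdisp _ _ (hflow x).isOpen (hflow x).ordConnected (hflow x).integral 0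
            (hflow x).zero_mem u hu'.2.2
            (by rw [flow_zero, ← hqx]; exact mem_of_mem_nhds hN') (by rw [h0]; exact hu'.2.1)
          have h2 : ζ u = flow hu x u := if_pos (not_le.1 hu0)
          rw [flow_zero, h0, ← h2] at h1
          refine ⟨hWsrc h1.1, ?_⟩
          have h3 : extChartAt (𝓡 n) q x = extChartAt (𝓡 n) q q := by rw [hqx]
          rw [← h3]
          exact h1.2
      · filter_upwards [hnb, lt_mem_nhds h0] with u hu' hu0
        exact hright u hu0.le hu'.1 hu'.2.1
  have hfinal := (flow_unique hu hcurve).2 ⟨hx ht₀, htδ⟩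
  have : η t₀ = flow hu x t₀ := by
    rw [← hfinal]
    exact (if_neg ht₀.not_gt).symm
  have hlast := hη t₀ ⟨ht₀, htδ.le⟩
  rw [this] at hlast
  exact hlast

/-- Compactness of the orbit segment gives one δ along all of it; the time-T map is a composition of
m maps of time T / m < δ. -/
lemma pointwise_continuity {x : M} (hx : x ∈ forwardComplete hu) {T : ℝ} (hT : 0 ≤ T) :
    ContinuousWithinAt (fun y => flow hu y T) (forwardComplete hu) x := by
  have hcomp : IsCompact (flow hu x '' Icc 0 T) :=
    isCompact_Icc.image_of_continuousOn
      ((flow_isMaximal hu x).integral.continuousOn.mono (Icc_subset_Ici_self.trans hx))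
  obtain ⟨δ, hδ, h⟩ := hcomp.induction_on
    (p := fun S => ∃ δ > 0, ∀ y ∈ S, y ∈ forwardComplete hu → ∀ t, 0 ≤ t → t < δ →
      ContinuousWithinAt (fun y => flow hu y t) (forwardComplete hu) y)
    ⟨1, one_pos, by simp⟩
    (fun s t hst ⟨δ, hδ, h⟩ => ⟨δ, hδ, fun y hy => h y (hst hy)⟩)
    (fun s t ⟨δ, hδ, h⟩ ⟨δ', hδ', h'⟩ => ⟨min δ δ', lt_min hδ hδ', fun y hy hyD t ht htδ =>
      hy.elim (fun hy => h y hy hyD t ht (htδ.trans_le (min_le_left _ _)))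
        (fun hy => h' y hy hyD t ht (htδ.trans_le (min_le_right _ _)))⟩)
    (fun p _ => by
      obtain ⟨N, hN, δ, hδ, h⟩ := local_pointwise_continuity hu hX p
      exact ⟨N, mem_nhdsWithin_of_mem_nhds hN, δ, hδ, fun y hy hyD => h y hyD hy⟩)
  obtain ⟨m, hm⟩ := exists_nat_gt (T / δ)
  have hm0 : (0 : ℝ) < m := (div_nonneg hT hδ.le).trans_lt hm
  have hstep : T / m < δ := by
    rw [div_lt_iff₀ hm0]
    rw [div_lt_iff₀ hδ] at hm
    linarith
  have key : ∀ k : ℕ, k ≤ m →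
      ContinuousWithinAt (fun y => flow hu y (k * (T / m))) (forwardComplete hu) x := by
    intro k
    induction k with
    | zero =>
      intro _
      simp only [Nat.cast_zero, zero_mul, flow_zero]
      exact continuousWithinAt_id
    | succ k ih =>
      intro hk
      have hk0 : (0 : ℝ) ≤ k * (T / m) := by positivity
      have hkT : k * (T / m) ≤ T := by
        rw [mul_div_assoc', div_le_iff₀ hm0, mul_comm]
        exact mul_le_mul_of_nonneg_left (by exact_mod_cast (Nat.le_succ k).trans hk) hT
      have h1 := h (flow hu x (k * (T / m))) ⟨_, ⟨hk0, hkT⟩, rfl⟩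
        (flow_mem_forwardComplete hu hx hk0) (T / m) (by positivity) hstep
      have h2 := ContinuousWithinAt.comp
        (f := fun y => flow hu y (k * (T / m))) (t := forwardComplete hu) h1
        (ih ((Nat.le_succ k).trans hk)) (fun y hy => flow_mem_forwardComplete hu hy hk0)
      have h3 : ∀ y ∈ forwardComplete hu, flow hu y ((k + 1 : ℕ) * (T / m)) =
          flow hu (flow hu y (k * (T / m))) (T / m) := fun y hy => by
        rw [flow_add hu hy (by positivity) hk0]
        congr 1
        push_cast
        ring
      exact h2.congr h3 (h3 x hx)
  have := key m le_rfl
  rwa [mul_div_cancel₀ _ hm0.ne'] at this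

/-- Continuity of the forward flow. -/
theorem continuousOn_flow : ContinuousOn (fun q : ℝ × M => flow hu q.2 q.1)
    (Ici 0 ×ˢ forwardComplete hu) := by
  rintro ⟨t, x⟩ ⟨ht, hx⟩
  intro W hW
  -- Continuity in x at the fixed time t brings orbits into N; confinement, uniform over curves,
  -- absorbs the change of time.
  obtain ⟨N, hN, δ, hδ, h⟩ := confinement hX (flow hu x t) hW
  have h1 : ∀ᶠ y in 𝓝[forwardComplete hu] x, flow hu y t ∈ N :=
    pointwise_continuity hu hX hx ht hN
  have h2 : ∀ᶠ s in 𝓝[Ici 0] t, |s - t| ≤ δ := by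
    refine mem_nhdsWithin_of_mem_nhds ?_
    filter_upwards [Metric.ball_mem_nhds t hδ] with u hu'
    rw [Metric.mem_ball, Real.dist_eq] at hu'
    exact hu'.le
  rw [nhdsWithin_prod_eq, Filter.mem_map]
  filter_upwards [((h2.and self_mem_nhdsWithin).prod_mk (h1.and self_mem_nhdsWithin))]
    with ⟨s, y⟩ hsy
  have hy := flow_isMaximal hu y
  exact h _ _ hy.isOpen hy.ordConnected hy.integral t (hsy.2.2 ht) s (hsy.2.2 hsy.1.2) hsy.2.1
    hsy.1.1

end Continuity

end VectorFieldFlow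

/-! ### The basin of attraction. -/

namespace VectorFieldFlow

variable {n : ℕ} {M : Type*} [TopologicalSpace M] [ChartedSpace (EuclideanSpace ℝ (Fin n)) M]
  [IsManifold (𝓡 n) ∞ M] {X : ∀ x : M, TangentSpace (𝓡 n) x}

section Basin

variable (hu : UniquelyIntegrable X) {A : Set M}

/-- The basin of attraction of `A`. -/
def basin (hu : UniquelyIntegrable X) (A : Set M) : Set M :=
  {x | x ∈ forwardComplete hu ∧ Tendsto (flow hu x) atTop (𝓝ˢ A)}

lemma flow_mem_basin {x : M} (hx : x ∈ basin hu A) {t : ℝ} (ht : 0 ≤ t) :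
    flow hu x t ∈ basin hu A := by
  refine ⟨flow_mem_forwardComplete hu hx.1 ht, ?_⟩
  have h1 : Tendsto (fun s => flow hu x (s + t)) atTop (𝓝ˢ A) :=
    hx.2.comp (tendsto_atTop_add_const_right _ _ tendsto_id)
  refine h1.congr' ?_
  filter_upwards [eventually_ge_atTop 0] with s hs
  exact (flow_add hu hx.1 hs ht).symm

/-- An orbit reaching A could be followed back from A to x, against invariance in backward time. -/
lemma flow_notMem (hA : IsInvariantSet X A) {x : M} (hx : x ∈ forwardComplete hu) (hxA : x ∉ A)
    {t : ℝ} (ht : 0 ≤ t) : flow hu x t ∉ A := by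
  intro h
  have h0 : -t + t ∈ flowDom hu x := by
    rw [neg_add_cancel]
    exact (flow_isMaximal hu x).zero_mem
  obtain ⟨h1, h2⟩ := flow_shift hu (hx ht) h0
  rw [neg_add_cancel, flow_zero] at h2
  exact hxA (h2 ▸ hA _ h _ _ (flow_isMaximal hu _) _ h1)

lemma exists_nhds_flow_mem (hA : IsAsymptoticallyStable X A) {W : Set M} (hW : IsOpen W)
    (hAW : A ⊆ W) : ∃ V : Set M, IsOpen V ∧ A ⊆ V ∧ V ⊆ W ∧
      ∀ x ∈ V, x ∈ basin hu A ∧ ∀ t, 0 ≤ t → flow hu x t ∈ W := by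
  obtain ⟨V, hV, hAV, h⟩ := hA.attracting W hW hAW
  have h' := fun x hx => h x hx _ _ (flow_isMaximal hu x)
  refine ⟨V, hV, hAV, fun x hx => ?_, fun x hx => ⟨⟨(h' x hx).1, (h' x hx).2.2⟩, (h' x hx).2.1⟩⟩
  have := (h' x hx).2.1 0 le_rfl
  rwa [flow_zero] at this

variable [T2Space M]

/-- Stability makes the time locally uniform: the orbit of x enters at time T a neighbourhood V
whose orbits never leave W, and by continuity nearby orbits are in V at the same time T. -/
lemma eventually_flow_mem (hX : CoordContinuous X) (hA : IsAsymptoticallyStable X A) {x : M}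
    (hx : x ∈ basin hu A) {W : Set M} (hW : IsOpen W) (hAW : A ⊆ W) :
    ∃ T : ℝ, 0 < T ∧ ∀ᶠ y in 𝓝[basin hu A] x, ∀ t, T ≤ t → flow hu y t ∈ W := by
  obtain ⟨V, hV, hAV, -, h⟩ := exists_nhds_flow_mem hu hA hW hAW
  obtain ⟨T, hTV, hT⟩ := ((hx.2.eventually (hV.mem_nhdsSet.2 hAV)).and (eventually_gt_atTop 0)).exists
  refine ⟨T, hT, ?_⟩
  have hsub : basin hu A ⊆ forwardComplete hu := fun y hy => hy.1
  have hc := (pointwise_continuity hu hX hx.1 hT.le).mono hsub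
  filter_upwards [hc (hV.mem_nhds hTV), self_mem_nhdsWithin] with y hyV hy t ht
  have h1 := (h _ hyV).2 (t - T) (sub_nonneg.2 ht)
  rwa [flow_add hu hy.1 (sub_nonneg.2 ht) hT.le, sub_add_cancel] at h1

/-- A return to x at time t repeats at all multiples of t, but the complement of x is a
neighbourhood of A. -/
lemma flow_ne_self {x : M} (hx : x ∈ basin hu A) (hxA : x ∉ A) {t : ℝ} (ht : 0 < t) :
    flow hu x t ≠ x := by
  intro h
  have hk : ∀ k : ℕ, flow hu x (k * t) = x := by
    intro k
    induction k with
    | zero => rw [Nat.cast_zero, zero_mul, flow_zero]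
    | succ k ih =>
      have h1 := flow_add hu hx.1 (t := k * t) ht.le (by positivity)
      rw [ih, h] at h1
      have h2 : ((k + 1 : ℕ) : ℝ) * t = t + k * t := by
        push_cast
        ring
      rw [h2, ← h1]
  have h1 : Tendsto (fun k : ℕ => (k : ℝ) * t) atTop atTop :=
    tendsto_natCast_atTop_atTop.atTop_mul_const ht
  have h2 : ({x}ᶜ : Set M) ∈ 𝓝ˢ A :=
    isOpen_compl_singleton.mem_nhdsSet.2 fun y hy hyx => hxA (hyx ▸ hy)
  obtain ⟨k, hk'⟩ := ((hx.2.comp h1).eventually h2).exists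
  exact hk' (hk k)

lemma ne_zero_of_mem_basin {x : M} (hx : x ∈ basin hu A) (hxA : x ∉ A) : X x ≠ 0 := by
  intro h
  have h1 : IsIntegralCurveFrom X x univ fun _ => x :=
    ⟨isOpen_univ, ordConnected_univ, mem_univ _, rfl,
      (isMIntegralCurve_const h).isMIntegralCurveOn _⟩
  exact flow_ne_self hu hx hxA one_pos ((flow_unique hu h1).2 (mem_univ 1)).symm

end Basin

end VectorFieldFlow

/-! ### Displacement vectors between nearby points. -/

namespace VectorFieldFlow

variable {n : ℕ} {M : Type*} [TopologicalSpace M] [ChartedSpace (EuclideanSpace ℝ (Fin n)) M]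
  [IsManifold (𝓡 n) ∞ M]

section Displacement

open Asymptotics

/-- The weighted sum of the coordinate differences from `x` to `y`, as a tangent vector at `x`. -/
def displacementVector (ρ : PartitionOfUnity M M univ) (x y : M) : EuclideanSpace ℝ (Fin n) :=
  ∑ᶠ i, ρ i x • tangentCoordChange (𝓡 n) i x x
    (extChartAt (𝓡 n) i y - extChartAt (𝓡 n) i x)

/-- The coordinates at `p` of the displacement vector, near `p`. -/
def localDisplacement (ρ : PartitionOfUnity M M univ) (p x y : M) : EuclideanSpace ℝ (Fin n) :=
  ∑ i ∈ ρ.fintsupport p, ρ i x • tangentCoordChange (𝓡 n) i p x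
    (extChartAt (𝓡 n) i y - extChartAt (𝓡 n) i x)

variable {ρ : PartitionOfUnity M M univ}

/-- Near p one finite index set serves all x, so in the coordinates at p the locally finite sum
becomes a fixed finite sum, by the cocycle rule. -/
lemma tangentCoordChange_displacementVector
    (hρ : ρ.IsSubordinate fun i => (extChartAt (𝓡 n) i).source) {p x : M}
    (hx : x ∈ (extChartAt (𝓡 n) p).source) (hF : ρ.finsupport x ⊆ ρ.fintsupport p) (y : M) :
    tangentCoordChange (𝓡 n) x p x (displacementVector ρ x y) =
      (localDisplacement ρ p x y : EuclideanSpace ℝ (Fin n)) := by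
  have h1 : (displacementVector ρ x y : EuclideanSpace ℝ (Fin n)) =
      ∑ i ∈ ρ.fintsupport p, ρ i x • tangentCoordChange (𝓡 n) i x x
        (extChartAt (𝓡 n) i y - extChartAt (𝓡 n) i x) := by
    refine finsum_eq_sum_of_support_subset _ fun i hi => hF ?_
    rw [PartitionOfUnity.mem_finsupport]
    intro h0
    exact hi (by simp only [h0, zero_smul])
  rw [h1, map_sum]
  refine Finset.sum_congr rfl fun i _ => ?_
  rw [map_smul]
  by_cases h0 : ρ i x = 0
  · rw [h0, zero_smul, zero_smul]
  · have hi : x ∈ (extChartAt (𝓡 n) i).source := hρ i (subset_tsupport _ h0)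
    rw [tangentCoordChange_comp ⟨⟨hi, mem_extChartAt_source x⟩, hx⟩]

lemma eventually_fintsupport_source
    (hρ : ρ.IsSubordinate fun i => (extChartAt (𝓡 n) i).source) (p : M) :
    ∀ᶠ x in 𝓝 p, ∀ i ∈ ρ.fintsupport p, x ∈ (extChartAt (𝓡 n) i).source := by
  rw [Filter.eventually_all_finset]
  intro i hi
  exact (isOpen_extChartAt_source (I := 𝓡 n) i).mem_nhds
    (hρ i ((ρ.mem_fintsupport_iff p i).1 hi))

lemma continuousAt_localDisplacement {p x y : M} (hp : x ∈ (extChartAt (𝓡 n) p).source)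
    (hx : ∀ i ∈ ρ.fintsupport p, x ∈ (extChartAt (𝓡 n) i).source)
    (hy : ∀ i ∈ ρ.fintsupport p, y ∈ (extChartAt (𝓡 n) i).source) :
    ContinuousAt (fun z : M × M => (localDisplacement ρ p z.1 z.2 : EuclideanSpace ℝ (Fin n)))
      (x, y) := by
  unfold localDisplacement
  refine tendsto_finsetSum _ fun i hi => ?_
  have h1 : ContinuousAt (fun z : M × M => ρ i z.1) (x, y) :=
    ((ρ i).continuous.comp continuous_fst).continuousAt
  have h2 : ContinuousAt (fun z : M × M => tangentCoordChange (𝓡 n) i p z.1) (x, y) := by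
    have h3 := (continuousOn_tangentCoordChange (I := 𝓡 n) i p).continuousAt
      (((isOpen_extChartAt_source (I := 𝓡 n) i).inter
        (isOpen_extChartAt_source (I := 𝓡 n) p)).mem_nhds ⟨hx i hi, hp⟩)
    exact ContinuousAt.comp (f := Prod.fst) (x := (x, y)) h3 continuousAt_fst
  have h4 : ContinuousAt (fun z : M × M => extChartAt (𝓡 n) i z.2 - extChartAt (𝓡 n) i z.1)
      (x, y) :=
    (ContinuousAt.comp (f := Prod.snd) (x := (x, y)) (continuousAt_extChartAt' (hy i hi))
      continuousAt_snd).sub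
    (ContinuousAt.comp (f := Prod.fst) (x := (x, y)) (continuousAt_extChartAt' (hx i hi))
      continuousAt_fst)
  exact h1.smul (h2.clm_apply h4)

/-- Strictness is needed because both endpoints of a displacement vary. -/
lemma hasStrictFDerivAt_chart_change {i p : M} (hp : p ∈ (extChartAt (𝓡 n) i).source) :
    HasStrictFDerivAt (extChartAt (𝓡 n) i ∘ (extChartAt (𝓡 n) p).symm)
      (tangentCoordChange (𝓡 n) p i p) (extChartAt (𝓡 n) p p) := by
  have h1 := contDiffWithinAt_ext_coord_change (I := 𝓡 n) (n := ∞) i p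
    (y := extChartAt (𝓡 n) p p) (by
      rw [PartialEquiv.trans_source'', PartialEquiv.symm_symm, PartialEquiv.symm_target]
      exact mem_image_of_mem _ ⟨mem_extChartAt_source p, hp⟩)
  have h2 : ContDiffAt ℝ ∞ (extChartAt (𝓡 n) i ∘ (extChartAt (𝓡 n) p).symm)
      (extChartAt (𝓡 n) p p) := by
    rwa [ModelWithCorners.range_eq_univ, contDiffWithinAt_univ] at h1
  have h3 := hasFDerivWithinAt_tangentCoordChange (I := 𝓡 n) (x := p) (y := i) (z := p)
    ⟨mem_extChartAt_source p, hp⟩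
  rw [ModelWithCorners.range_eq_univ, hasFDerivWithinAt_univ] at h3
  have h4 := h2.hasStrictFDerivAt (by simp)
  rwa [h3.fderiv] at h4

lemma chart_sub_isLittleO {i p : M} (hp : p ∈ (extChartAt (𝓡 n) i).source) :
    (fun z : M × M => extChartAt (𝓡 n) i z.2 - extChartAt (𝓡 n) i z.1 -
      tangentCoordChange (𝓡 n) p i p (extChartAt (𝓡 n) p z.2 - extChartAt (𝓡 n) p z.1))
      =o[𝓝 (p, p)] fun z => extChartAt (𝓡 n) p z.2 - extChartAt (𝓡 n) p z.1 := by
  have h1 := (hasStrictFDerivAt_chart_change hp).isLittleO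
  have hc := continuousAt_extChartAt (I := 𝓡 n) p
  have h2 : Tendsto (fun z : M × M => (extChartAt (𝓡 n) p z.2, extChartAt (𝓡 n) p z.1)) (𝓝 (p, p))
      (𝓝 (extChartAt (𝓡 n) p p, extChartAt (𝓡 n) p p)) :=
    (ContinuousAt.comp (f := Prod.snd) (x := (p, p)) hc continuousAt_snd).prodMk_nhds
      (ContinuousAt.comp (f := Prod.fst) (x := (p, p)) hc continuousAt_fst)
  have h3 := h1.comp_tendsto h2
  refine h3.congr' ?_ EventuallyEq.rfl
  have hs := extChartAt_source_mem_nhds (I := 𝓡 n) p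
  rw [nhds_prod_eq]
  filter_upwards [prod_mem_prod hs hs] with z hz
  simp only [Function.comp_apply, (extChartAt (𝓡 n) p).left_inv hz.1,
    (extChartAt (𝓡 n) p).left_inv hz.2]

/-- Every chart measures the same displacement to first order once transported to p, and the weights
sum to 1. -/
lemma localDisplacement_isLittleO
    (hρ : ρ.IsSubordinate fun i => (extChartAt (𝓡 n) i).source) (p : M) :
    (fun z : M × M => localDisplacement ρ p z.1 z.2 -
      (extChartAt (𝓡 n) p z.2 - extChartAt (𝓡 n) p z.1))
      =o[𝓝 (p, p)] fun z => extChartAt (𝓡 n) p z.2 - extChartAt (𝓡 n) p z.1 := by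
  have hterm : ∀ i ∈ ρ.fintsupport p, (fun z : M × M => ρ i z.1 •
      (tangentCoordChange (𝓡 n) i p z.1 (extChartAt (𝓡 n) i z.2 - extChartAt (𝓡 n) i z.1) -
        (extChartAt (𝓡 n) p z.2 - extChartAt (𝓡 n) p z.1)))
      =o[𝓝 (p, p)] fun z => extChartAt (𝓡 n) p z.2 - extChartAt (𝓡 n) p z.1 := by
    intro i hi
    have hip : p ∈ (extChartAt (𝓡 n) i).source := hρ i ((ρ.mem_fintsupport_iff p i).1 hi)
    have h1 := chart_sub_isLittleO (n := n) hip
    have hO : (fun z : M × M => extChartAt (𝓡 n) i z.2 - extChartAt (𝓡 n) i z.1)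
        =O[𝓝 (p, p)] fun z => extChartAt (𝓡 n) p z.2 - extChartAt (𝓡 n) p z.1 := by
      have := h1.isBigO.add ((tangentCoordChange (𝓡 n) p i p).isBigO_comp
        (fun z : M × M => extChartAt (𝓡 n) p z.2 - extChartAt (𝓡 n) p z.1) (𝓝 (p, p)))
      simpa using this
    have hA : Tendsto (fun z : M × M => tangentCoordChange (𝓡 n) i p z.1 -
        tangentCoordChange (𝓡 n) i p p) (𝓝 (p, p)) (𝓝 0) := by
      have h3 := (continuousOn_tangentCoordChange (I := 𝓡 n) i p).continuousAt
        (((isOpen_extChartAt_source (I := 𝓡 n) i).inter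
          (isOpen_extChartAt_source (I := 𝓡 n) p)).mem_nhds ⟨hip, mem_extChartAt_source p⟩)
      have h4 : Tendsto (fun z : M × M => tangentCoordChange (𝓡 n) i p z.1 -
          tangentCoordChange (𝓡 n) i p p) (𝓝 (p, p)) (𝓝 (tangentCoordChange (𝓡 n) i p p -
          tangentCoordChange (𝓡 n) i p p)) :=
        (ContinuousAt.comp (f := Prod.fst) (x := (p, p)) h3 continuousAt_fst).sub
        (continuousAt_const (y := tangentCoordChange (𝓡 n) i p p))
      rwa [sub_self] at h4
    have h2 : (fun z : M × M => (tangentCoordChange (𝓡 n) i p z.1 -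
        tangentCoordChange (𝓡 n) i p p) (extChartAt (𝓡 n) i z.2 - extChartAt (𝓡 n) i z.1))
        =o[𝓝 (p, p)] fun z => extChartAt (𝓡 n) p z.2 - extChartAt (𝓡 n) p z.1 := by
      have h5 : (fun z : M × M => ‖tangentCoordChange (𝓡 n) i p z.1 -
          tangentCoordChange (𝓡 n) i p p‖ * ‖extChartAt (𝓡 n) i z.2 - extChartAt (𝓡 n) i z.1‖)
          =o[𝓝 (p, p)] fun z => (1 : ℝ) * ‖extChartAt (𝓡 n) p z.2 - extChartAt (𝓡 n) p z.1‖ :=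
        ((isLittleO_one_iff ℝ).2 hA).norm_left.mul_isBigO hO.norm_norm
      simp only [one_mul] at h5
      refine IsBigO.trans_isLittleO (IsBigO.of_bound 1 (Eventually.of_forall fun z => ?_))
        h5.of_norm_right
      rw [one_mul, norm_mul, norm_norm, norm_norm]
      exact ContinuousLinearMap.le_opNorm _ _
    have h6 := ((tangentCoordChange (𝓡 n) i p p).isBigO_comp _ _).trans_isLittleO h1
    have h7 := h2.add h6
    have hb : (fun z : M × M => ρ i z.1) =O[𝓝 (p, p)] fun _ => (1 : ℝ) :=
      (((ρ i).continuous.comp continuous_fst).continuousAt (x := (p, p))).isBigO_one ℝ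
    have h8 := hb.smul_isLittleO h7
    simp only [one_smul] at h8
    refine h8.congr (fun z => ?_) fun _ => rfl
    have hcc : tangentCoordChange (𝓡 n) i p p (tangentCoordChange (𝓡 n) p i p
        (extChartAt (𝓡 n) p z.2 - extChartAt (𝓡 n) p z.1)) =
        extChartAt (𝓡 n) p z.2 - extChartAt (𝓡 n) p z.1 := by
      rw [tangentCoordChange_comp ⟨⟨mem_extChartAt_source p, hip⟩, mem_extChartAt_source p⟩,
        tangentCoordChange_self (mem_extChartAt_source p)]
    congr 1
    rw [map_sub (tangentCoordChange (𝓡 n) i p p), hcc, _root_.sub_apply]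
    abel
  have hsum := IsLittleO.sum hterm
  have hF : ∀ᶠ z : M × M in 𝓝 (p, p), ρ.finsupport z.1 ⊆ ρ.fintsupport p :=
    (continuousAt_fst (p := (p, p))).eventually (ρ.eventually_finsupport_subset p)
  refine hsum.congr' ?_ EventuallyEq.rfl
  filter_upwards [hF] with z hz
  unfold localDisplacement
  rw [Finset.sum_apply]
  simp only [smul_sub, Finset.sum_sub_distrib]
  rw [← Finset.sum_smul, ← Finset.sum_smul, ρ.sum_finsupport' (mem_univ _) hz, one_smul, one_smul]

/-- There is a continuous family of tangent vectors `v x y` at `x`, defined near the diagonal,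
vanishing only on it, and equal to the coordinate displacement from `x` to `y` to first order. -/
theorem exists_displacementVector [T2Space M] [SecondCountableTopology M] :
    ∃ (v : M → M → EuclideanSpace ℝ (Fin n)) (O : Set (M × M)), IsOpen O ∧ (∀ p, (p, p) ∈ O) ∧
      ContinuousOn (fun z : M × M => (⟨z.1, v z.1 z.2⟩ : TangentBundle (𝓡 n) M)) O ∧
      (∀ z ∈ O, v z.1 z.2 = 0 → z.1 = z.2) ∧
      ∀ p, (fun z : M × M => tangentCoordChange (𝓡 n) z.1 p z.1 (v z.1 z.2) -
        (extChartAt (𝓡 n) p z.2 - extChartAt (𝓡 n) p z.1))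
        =o[𝓝 (p, p)] fun z => extChartAt (𝓡 n) p z.2 - extChartAt (𝓡 n) p z.1 := by
  have : LocallyCompactSpace M := ChartedSpace.locallyCompactSpace (EuclideanSpace ℝ (Fin n)) M
  obtain ⟨ρ, hρ⟩ := PartitionOfUnity.exists_isSubordinate (isClosed_univ (X := M))
    (fun i : M => (extChartAt (𝓡 n) i).source) (fun i => isOpen_extChartAt_source i)
    fun x _ => mem_iUnion.2 ⟨x, mem_extChartAt_source x⟩
  have hN : ∀ p : M, ∀ᶠ x in 𝓝 p, x ∈ (extChartAt (𝓡 n) p).source ∧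
      ρ.finsupport x ⊆ ρ.fintsupport p ∧
      ∀ i ∈ ρ.fintsupport p, x ∈ (extChartAt (𝓡 n) i).source := fun p =>
    Filter.Eventually.and (extChartAt_source_mem_nhds (I := 𝓡 n) p) ((ρ.eventually_finsupport_subset p).and
      (eventually_fintsupport_source hρ p))
  have hlit : ∀ p : M, (fun z : M × M =>
      tangentCoordChange (𝓡 n) z.1 p z.1 (displacementVector ρ z.1 z.2) -
        (extChartAt (𝓡 n) p z.2 - extChartAt (𝓡 n) p z.1))
        =o[𝓝 (p, p)] fun z => extChartAt (𝓡 n) p z.2 - extChartAt (𝓡 n) p z.1 := by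
    intro p
    refine (localDisplacement_isLittleO hρ p).congr' ?_ EventuallyEq.rfl
    filter_upwards [(continuousAt_fst (p := (p, p))).eventually (hN p)] with z hz
    rw [tangentCoordChange_displacementVector hρ hz.1 hz.2.1]
  have hev : ∀ p : M, ∀ᶠ z : M × M in 𝓝 (p, p),
      ContinuousAt (fun z : M × M =>
        (⟨z.1, displacementVector ρ z.1 z.2⟩ : TangentBundle (𝓡 n) M)) z ∧
      ((displacementVector ρ z.1 z.2 : EuclideanSpace ℝ (Fin n)) = 0 → z.1 = z.2) := by
    intro p
    have h1 := (continuousAt_fst (p := (p, p))).eventually (eventually_eventually_nhds.2 (hN p))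
    have h2 := (continuousAt_snd (p := (p, p))).eventually (hN p)
    -- With constant 1 / 2, a zero of the displacement vector forces the coordinate difference to be
    -- at most half its own norm, so it vanishes and the chart identifies the points.
    filter_upwards [h1, h2, (hlit p).bound (half_pos one_pos)] with z hz1 hz2 hz
    constructor
    · have hz3 := hz1.self_of_nhds
      refine ((trivializationAt (EuclideanSpace ℝ (Fin n)) (TangentSpace (𝓡 n)) p).tendsto_nhds_iff
        ?_).2 ⟨continuousAt_fst, ?_⟩
      · rw [Bundle.Trivialization.mem_source]
        simpa using hz3.1
      · have hc := continuousAt_localDisplacement (ρ := ρ) hz3.1 hz3.2.2 hz2.2.2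
        have he : (fun w : M × M => (localDisplacement ρ p w.1 w.2 : EuclideanSpace ℝ (Fin n)))
            =ᶠ[𝓝 z] fun w => tangentCoordChange (𝓡 n) w.1 p w.1 (displacementVector ρ w.1 w.2) := by
          filter_upwards [(continuousAt_fst (p := z)).eventually hz1] with w hw
          rw [tangentCoordChange_displacementVector hρ hw.1 hw.2.1]
        exact (continuousAt_congr he).1 hc
    · intro h0
      rw [h0, map_zero, zero_sub, norm_neg] at hz
      have h3 : ‖extChartAt (𝓡 n) p z.2 - extChartAt (𝓡 n) p z.1‖ = 0 :=
        le_antisymm (by linarith) (norm_nonneg _)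
      exact (extChartAt (𝓡 n) p).injOn hz1.self_of_nhds.1 hz2.1
        (sub_eq_zero.1 (norm_eq_zero.1 h3)).symm
  refine ⟨displacementVector ρ, interior {z | ContinuousAt (fun z : M × M =>
        (⟨z.1, displacementVector ρ z.1 z.2⟩ : TangentBundle (𝓡 n) M)) z ∧
      ((displacementVector ρ z.1 z.2 : EuclideanSpace ℝ (Fin n)) = 0 → z.1 = z.2)},
    isOpen_interior, fun p => mem_interior_iff_mem_nhds.2 (hev p), ?_, ?_, hlit⟩
  · exact fun z hz => ((interior_subset hz).1).continuousWithinAt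
  · exact fun z hz => (interior_subset hz).2

end Displacement

end VectorFieldFlow

/-! ### Difference quotients of the flow, continuous up to time zero. -/

namespace VectorFieldFlow

variable {n : ℕ} {M : Type*} [TopologicalSpace M] [ChartedSpace (EuclideanSpace ℝ (Fin n)) M]
  [IsManifold (𝓡 n) ∞ M] {X : ∀ x : M, TangentSpace (𝓡 n) x}

section Difference

lemma tendsto_tangentBundle_iff {α : Type*} {l : Filter α} {b : α → M}
    {w : α → EuclideanSpace ℝ (Fin n)} {p x : M} {y : EuclideanSpace ℝ (Fin n)}
    (hx : x ∈ (extChartAt (𝓡 n) p).source) :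
    Tendsto (fun z => (⟨b z, w z⟩ : TangentBundle (𝓡 n) M)) l
      (𝓝 (⟨x, y⟩ : TangentBundle (𝓡 n) M)) ↔
      Tendsto b l (𝓝 x) ∧ Tendsto (fun z => tangentCoordChange (𝓡 n) (b z) p (b z) (w z)) l
        (𝓝 (tangentCoordChange (𝓡 n) x p x y)) := by
  refine (trivializationAt (EuclideanSpace ℝ (Fin n)) (TangentSpace (𝓡 n)) p).tendsto_nhds_iff
    (z := (⟨x, y⟩ : TangentBundle (𝓡 n) M)) ?_
  rw [Bundle.Trivialization.mem_source]
  simpa using hx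

lemma tendsto_tangentBundle_smul {α : Type*} {l : Filter α} {b : α → M}
    {w : α → EuclideanSpace ℝ (Fin n)} {x : M} {y : EuclideanSpace ℝ (Fin n)}
    (h : Tendsto (fun z => (⟨b z, w z⟩ : TangentBundle (𝓡 n) M)) l
      (𝓝 (⟨x, y⟩ : TangentBundle (𝓡 n) M))) {c : α → ℝ} {a : ℝ} (hc : Tendsto c l (𝓝 a)) :
    Tendsto (fun z => (⟨b z, c z • w z⟩ : TangentBundle (𝓡 n) M)) l
      (𝓝 (⟨x, a • y⟩ : TangentBundle (𝓡 n) M)) := by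
  have hx := mem_extChartAt_source (I := 𝓡 n) x
  rw [tendsto_tangentBundle_iff hx] at h ⊢
  simp only [map_smul]
  exact ⟨h.1, hc.smul h.2⟩

variable (hu : UniquelyIntegrable X)

/-- The difference quotient of the flow in terms of displacement vectors `v`, extended by the
vector field at time zero. -/
def differenceQuotient (hu : UniquelyIntegrable X) (v : M → M → EuclideanSpace ℝ (Fin n)) (t : ℝ)
    (x : M) : EuclideanSpace ℝ (Fin n) :=
  if t = 0 then X x else t⁻¹ • v x (flow hu x t)

lemma differenceQuotient_zero (v : M → M → EuclideanSpace ℝ (Fin n)) (x : M) :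
    differenceQuotient hu v 0 x = X x := if_pos rfl

lemma differenceQuotient_of_ne (v : M → M → EuclideanSpace ℝ (Fin n)) {t : ℝ} (ht : t ≠ 0)
    (x : M) : differenceQuotient hu v t x = t⁻¹ • v x (flow hu x t) := if_neg ht

lemma tangentCoordChange_differenceQuotient_zero (v : M → M → EuclideanSpace ℝ (Fin n)) (p x : M) :
    tangentCoordChange (𝓡 n) x p x (differenceQuotient hu v 0 x) = coordField X p x :=
  congrArg (tangentCoordChange (𝓡 n) x p x) (differenceQuotient_zero hu v x)

variable [T2Space M]

lemma continuousOn_graph (hX : CoordContinuous X) :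
    ContinuousOn (fun q : ℝ × M => (q.2, flow hu q.2 q.1)) (Ici 0 ×ˢ forwardComplete hu) :=
  continuousOn_snd.prodMk (continuousOn_flow hu hX)

/-- Two uniform estimates combine: v is the coordinate difference to first order, and that
difference is t times the field at p up to o(t), for all starting points near p. -/
lemma tendsto_differenceQuotient_coord (hX : CoordContinuous X)
    {v : M → M → EuclideanSpace ℝ (Fin n)} {p : M} (hp : p ∈ forwardComplete hu)
    (hv : (fun z : M × M => tangentCoordChange (𝓡 n) z.1 p z.1 (v z.1 z.2) -
        (extChartAt (𝓡 n) p z.2 - extChartAt (𝓡 n) p z.1))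
        =o[𝓝 (p, p)] fun z => extChartAt (𝓡 n) p z.2 - extChartAt (𝓡 n) p z.1) :
    Tendsto (fun q : ℝ × M => tangentCoordChange (𝓡 n) q.2 p q.2
      (differenceQuotient hu v q.1 q.2)) (𝓝[Ici 0 ×ˢ forwardComplete hu] (0, p))
      (𝓝 (coordField X p p)) := by
  rw [Metric.tendsto_nhds]
  intro ε hε
  set a := ‖coordField X p p‖ with ha
  have ha0 : 0 ≤ a := norm_nonneg _
  -- The coordinate difference has norm at most (a + 1) * t, as η ≤ 1. The two errors η * (a + 1) *
  -- t and η * t add up to η * (a + 2) * t.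
  obtain ⟨η, hη0, hη1, hη⟩ : ∃ η : ℝ, 0 < η ∧ η ≤ 1 ∧ η * (a + 2) < ε := by
    refine ⟨min 1 (ε / (2 * (a + 2))), by positivity, min_le_left _ _, ?_⟩
    have h1 := min_le_right 1 (ε / (2 * (a + 2)))
    have h2 : ε / (2 * (a + 2)) * (a + 2) = ε / 2 := by field_simp
    nlinarith
  obtain ⟨N, hN, δ, hδ, h⟩ := displacement hX p univ_mem hη0
  have htend : Tendsto (fun q : ℝ × M => (q.2, flow hu q.2 q.1))
      (𝓝[Ici 0 ×ˢ forwardComplete hu] (0, p)) (𝓝 (p, p)) := by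
    have h1 := continuousOn_graph hu hX (0, p) ⟨mem_Ici.2 le_rfl, hp⟩
    rw [ContinuousWithinAt] at h1
    simpa only [flow_zero] using h1
  have hlit := htend.eventually (hv.bound hη0)
  have hfield : ∀ᶠ q : ℝ × M in 𝓝[Ici 0 ×ˢ forwardComplete hu] (0, p),
      dist (coordField X p q.2) (coordField X p p) < ε := by
    have h1 : Tendsto (fun q : ℝ × M => coordField X p q.2)
        (𝓝[Ici 0 ×ˢ forwardComplete hu] (0, p)) (𝓝 (coordField X p p)) :=
      ((hX p).continuousAt (extChartAt_source_mem_nhds p)).tendsto.comp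
        (continuous_snd.continuousWithinAt (x := ((0 : ℝ), p)))
    exact Metric.tendsto_nhds.1 h1 ε hε
  have hnear : ∀ᶠ q : ℝ × M in 𝓝[Ici 0 ×ˢ forwardComplete hu] (0, p), q.1 < δ ∧ q.2 ∈ N :=
    Filter.Eventually.filter_mono nhdsWithin_le_nhds
      (((continuousAt_fst (p := ((0 : ℝ), p))).eventually (gt_mem_nhds hδ)).and
        ((continuousAt_snd (p := ((0 : ℝ), p))).eventually hN))
  filter_upwards [hlit, hfield, hnear, self_mem_nhdsWithin] with q h1 h2 h3 h4
  obtain ⟨t, x⟩ := q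
  have ht0 : 0 ≤ t := h4.1
  by_cases ht : t = 0
  · subst ht
    rw [tangentCoordChange_differenceQuotient_zero]
    exact h2
  · have htpos : 0 < t := lt_of_le_of_ne ht0 (Ne.symm ht)
    rw [differenceQuotient_of_ne hu v ht, map_smul]
    have hmax := flow_isMaximal hu x
    have h5 := (h _ _ hmax.isOpen hmax.ordConnected hmax.integral 0 hmax.zero_mem t (h4.2 ht0)
      (by rw [flow_zero]; exact h3.2) (by rw [sub_zero, abs_of_pos htpos]; exact h3.1.le)).2
    rw [flow_zero, sub_zero, abs_of_pos htpos] at h5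
    simp only at h1 ⊢
    set c := coordField X p p
    set d := extChartAt (𝓡 n) p (flow hu x t) - extChartAt (𝓡 n) p x
    set w := tangentCoordChange (𝓡 n) x p x (v x (flow hu x t))
    have h6 : ‖d‖ ≤ (a + 1) * t := by
      have h7 : ‖d‖ ≤ ‖d - t • c‖ + ‖t • c‖ := by simpa using norm_add_le (d - t • c) (t • c)
      rw [norm_smul, Real.norm_eq_abs, abs_of_pos htpos] at h7
      nlinarith
    have h8 : ‖w - t • c‖ ≤ η * (a + 2) * t := by
      have h9 : ‖w - t • c‖ ≤ ‖w - d‖ + ‖d - t • c‖ := by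
        simpa using norm_add_le (w - d) (d - t • c)
      nlinarith
    have h10 : t⁻¹ • w - c = t⁻¹ • (w - t • c) := by
      rw [smul_sub, smul_smul, inv_mul_cancel₀ ht, one_smul]
    rw [dist_eq_norm, h10, norm_smul, norm_inv, Real.norm_eq_abs, abs_of_pos htpos]
    calc t⁻¹ * ‖w - t • c‖ ≤ t⁻¹ * (η * (a + 2) * t) := by gcongr
      _ = η * (a + 2) := by field_simp
      _ < ε := hη

lemma continuousOn_differenceQuotient (hX : CoordContinuous X)
    {v : M → M → EuclideanSpace ℝ (Fin n)} {O : Set (M × M)}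
    (hvc : ContinuousOn (fun z : M × M => (⟨z.1, v z.1 z.2⟩ : TangentBundle (𝓡 n) M)) O)
    (hv : ∀ p : M, (fun z : M × M => tangentCoordChange (𝓡 n) z.1 p z.1 (v z.1 z.2) -
        (extChartAt (𝓡 n) p z.2 - extChartAt (𝓡 n) p z.1))
        =o[𝓝 (p, p)] fun z => extChartAt (𝓡 n) p z.2 - extChartAt (𝓡 n) p z.1) :
    ContinuousOn (fun q : ℝ × M =>
      (⟨q.2, differenceQuotient hu v q.1 q.2⟩ : TangentBundle (𝓡 n) M))
      {q | 0 ≤ q.1 ∧ q.2 ∈ forwardComplete hu ∧ (q.2, flow hu q.2 q.1) ∈ O} := by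
  rintro ⟨t, x⟩ ⟨ht, hx, hO⟩
  have hsub : {q : ℝ × M | 0 ≤ q.1 ∧ q.2 ∈ forwardComplete hu ∧ (q.2, flow hu q.2 q.1) ∈ O} ⊆
      Ici 0 ×ˢ forwardComplete hu := fun q hq => ⟨hq.1, hq.2.1⟩
  rcases eq_or_lt_of_le (show 0 ≤ t from ht) with rfl | htpos
  · refine (tendsto_tangentBundle_iff (mem_extChartAt_source x)).2
      ⟨continuous_snd.continuousWithinAt, ?_⟩
    have h1 := (tendsto_differenceQuotient_coord hu hX hx (hv x)).mono_left
      (nhdsWithin_mono _ hsub)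
    rw [← tangentCoordChange_differenceQuotient_zero hu v] at h1
    exact h1
  · have h1 : ContinuousWithinAt (fun q : ℝ × M =>
        (⟨q.2, v q.2 (flow hu q.2 q.1)⟩ : TangentBundle (𝓡 n) M))
        {q | 0 ≤ q.1 ∧ q.2 ∈ forwardComplete hu ∧ (q.2, flow hu q.2 q.1) ∈ O} (t, x) :=
      ContinuousOn.comp hvc ((continuousOn_graph hu hX).mono hsub) (fun q hq => hq.2.2) (t, x)
        ⟨ht, hx, hO⟩
    have h2 : Tendsto (fun q : ℝ × M => q.1⁻¹) (𝓝[{q | 0 ≤ q.1 ∧ q.2 ∈ forwardComplete hu ∧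
        (q.2, flow hu q.2 q.1) ∈ O}] (t, x)) (𝓝 t⁻¹) :=
      (continuous_fst.continuousWithinAt (x := (t, x))).inv₀ htpos.ne'
    have h3 := tendsto_tangentBundle_smul h1 h2
    refine ContinuousWithinAt.congr_of_eventuallyEq (f := fun q : ℝ × M =>
      (⟨q.2, q.1⁻¹ • v q.2 (flow hu q.2 q.1)⟩ : TangentBundle (𝓡 n) M)) h3 ?_ ?_
    · filter_upwards [nhdsWithin_le_nhds ((continuousAt_fst (p := (t, x))).eventually
        (lt_mem_nhds htpos))] with q hq
      rw [differenceQuotient_of_ne hu v (ne_of_gt hq)]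
    · rw [differenceQuotient_of_ne hu v htpos.ne']

end Difference

end VectorFieldFlow

/-! ### Homotopies into subspaces and continuous choices of flow times. -/

section Homotopies

variable {S T : Type*} [TopologicalSpace S] [TopologicalSpace T]

lemma homotopic_subtype {Q : Set T} (f g : C(S, Q)) (K : ℝ × S → T)
    (hK : ContinuousOn K (Icc 0 1 ×ˢ univ)) (hKQ : ∀ s ∈ Icc (0 : ℝ) 1, ∀ x, K (s, x) ∈ Q)
    (h0 : ∀ x, K (0, x) = f x) (h1 : ∀ x, K (1, x) = g x) : f.Homotopic g := by
  refine ⟨⟨⟨fun q => ⟨K (q.1, q.2), hKQ _ q.1.2 _⟩, ?_⟩, fun x => Subtype.ext ?_, fun x =>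
    Subtype.ext ?_⟩⟩
  · refine Continuous.subtype_mk (hK.comp_continuous (by fun_prop) fun q => ⟨q.1.2, mem_univ _⟩) _
  · exact h0 x
  · exact h1 x

variable {C : Type*} [TopologicalSpace C]

/-- The map `x ↦ F (c x, x)` into a subspace. -/
def paramMap (F : C(C × S, T)) {Q : Set T} (c : S → C) (hc : Continuous c)
    (h : ∀ x, F (c x, x) ∈ Q) : C(S, Q) :=
  ⟨fun x => ⟨F (c x, x), h x⟩, by fun_prop⟩

lemma homotopic_paramMap (F : C(C × S, T)) {Q : Set T} {c₀ c₁ : S → C} (hc₀ : Continuous c₀)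
    (hc₁ : Continuous c₁) (h₀ : ∀ x, F (c₀ x, x) ∈ Q) (h₁ : ∀ x, F (c₁ x, x) ∈ Q)
    (c : ℝ × S → C) (hc : Continuous c) (h0 : ∀ x, c (0, x) = c₀ x) (h1 : ∀ x, c (1, x) = c₁ x)
    (h : ∀ s ∈ Icc (0 : ℝ) 1, ∀ x, F (c (s, x), x) ∈ Q) :
    (paramMap F c₀ hc₀ h₀).Homotopic (paramMap F c₁ hc₁ h₁) := by
  refine homotopic_subtype _ _ (fun q => F (c q, q.2)) ?_ h (fun x => ?_) fun x => ?_
  · exact Continuous.continuousOn (by fun_prop)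
  · exact congrArg (fun a => F (a, x)) (h0 x)
  · exact congrArg (fun a => F (a, x)) (h1 x)

variable [NormalSpace S] [ParacompactSpace S]

/-- The admissible values at each point form an upward closed set of positive reals. This is convex,
so local constants glue by a partition of unity. -/
lemma exists_continuous_large {p : S → ℝ → Prop} (hmono : ∀ x a b, a ≤ b → p x a → p x b)
    (h : ∀ x, ∃ a, ∀ᶠ y in 𝓝 x, p y a) : ∃ τ : C(S, ℝ), ∀ x, 0 < τ x ∧ p x (τ x) := by
  refine exists_continuous_forall_mem_convex_of_local_const (t := fun x => {a | 0 < a ∧ p x a})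
    (fun x => OrdConnected.convex ⟨fun a ha b _ c hc => ⟨ha.1.trans_le hc.1, hmono x a c hc.1 ha.2⟩⟩)
    fun x => ?_
  obtain ⟨a, ha⟩ := h x
  exact ⟨max a 1, ha.mono fun y hy => ⟨by positivity, hmono y a _ (le_max_left _ _) hy⟩⟩

lemma exists_continuous_small {p : S → ℝ → Prop} (hmono : ∀ x a b, a ≤ b → p x b → p x a)
    (h : ∀ x, ∃ a > 0, ∀ᶠ y in 𝓝 x, p y a) : ∃ τ : C(S, ℝ), ∀ x, 0 < τ x ∧ p x (τ x) := by
  refine exists_continuous_forall_mem_convex_of_local_const (t := fun x => {a | 0 < a ∧ p x a})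
    (fun x => OrdConnected.convex ⟨fun a ha b hb c hc => ⟨ha.1.trans_le hc.1, hmono x c b hc.2 hb.2⟩⟩)
    fun x => ?_
  obtain ⟨a, ha0, ha⟩ := h x
  exact ⟨a, ha.mono fun y hy => ⟨ha0, hy⟩⟩

end Homotopies

/-! ### Leaving the diagonal, and vector fields as short displacements. -/

namespace VectorFieldFlow

variable {n : ℕ} {M : Type u} [TopologicalSpace M] [ChartedSpace (EuclideanSpace ℝ (Fin n)) M]
  [IsManifold (𝓡 n) ∞ M] {X Y : ∀ x : M, TangentSpace (𝓡 n) x} [T2Space M]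

section Comparison

open SingularSubdivision

lemma exists_nhds_disjoint [RegularSpace M] {A : Set M} (hA : IsClosed A) {x : M} (hx : x ∉ A) :
    ∃ N ∈ 𝓝 x, ∃ W : Set M, IsOpen W ∧ A ⊆ W ∧ ∀ y ∈ N, y ∉ W := by
  obtain ⟨N, hN, hNc, hNA⟩ := exists_mem_nhds_isClosed_subset (hA.isOpen_compl.mem_nhds hx)
  exact ⟨N, hN, Nᶜ, hNc.isOpen_compl, fun a ha haN => hNA haN ha, fun y hy h => h hy⟩

variable (hXu : UniquelyIntegrable X) (hYu : UniquelyIntegrable Y)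

/-- Flowing in the second factor deforms `E × D` into the complement of the diagonal. -/
lemma exists_deformation_offDiagonal [SecondCountableTopology M] [LocallyCompactSpace M]
    (hX : CoordContinuous X) {A : Set M} (hA : IsAsymptoticallyStable X A) {E : Set M}
    (hE : ∀ x ∈ E, x ∉ A) :
    ∃ r : C(E × (basin hXu A \ A : Set M), {z : E × (basin hXu A \ A : Set M) | (z.1 : M) ≠ z.2}),
      ((subspaceIncl _).comp r).Homotopic (ContinuousMap.id _) := by
  -- A compatible metric makes the subspaces and products in play normal and paracompact, as the
  -- continuous choice of times requires.
  let _ : MetricSpace M := TopologicalSpace.metrizableSpaceMetric M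
  -- The first point is outside A while the orbit of the second is attracted to A, so after some
  -- time they never meet again. Asking this for all later times makes the condition monotone.
  obtain ⟨τ, hτ⟩ := exists_continuous_large (S := E × (basin hXu A \ A : Set M))
    (p := fun z a => ∀ t, a ≤ t → flow hXu z.2 t ≠ z.1)
    (fun z a b hab h t ht => h t (hab.trans ht)) (by
      rintro ⟨x, y⟩
      obtain ⟨N, hN, W, hW, hAW, hNW⟩ := exists_nhds_disjoint hA.isCompact.isClosed (hE x x.2)
      obtain ⟨T, -, hT⟩ := eventually_flow_mem hXu hX hA y.2.1 hW hAW
      refine ⟨T, ?_⟩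
      have h1 : ∀ᶠ z : E × (basin hXu A \ A : Set M) in 𝓝 (x, y), (z.1 : M) ∈ N :=
        (continuous_subtype_val.comp continuous_fst).continuousAt.eventually hN
      have h2 : Tendsto (fun z : E × (basin hXu A \ A : Set M) => (z.2 : M)) (𝓝 (x, y))
          (𝓝[basin hXu A] y) :=
        tendsto_nhdsWithin_iff.2 ⟨(continuous_subtype_val.comp continuous_snd).continuousAt,
          Eventually.of_forall fun z => z.2.2.1⟩
      filter_upwards [h1, h2.eventually hT] with z hz1 hz2 t ht h
      exact hNW _ hz1 (h ▸ hz2 t ht))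
  have hmem : ∀ (z : E × (basin hXu A \ A : Set M)) (t : ℝ),
      flow hXu z.2 (max t 0) ∈ basin hXu A \ A := fun z t =>
    ⟨flow_mem_basin hXu z.2.2.1 (le_max_right _ _),
      flow_notMem hXu hA.invariant z.2.2.1.1 z.2.2.2 (le_max_right _ _)⟩
  have hcont : Continuous fun q : ℝ × (E × (basin hXu A \ A : Set M)) =>
      flow hXu q.2.2 (max q.1 0) :=
    (continuousOn_flow hXu hX).comp_continuous
      (f := fun q : ℝ × (E × (basin hXu A \ A : Set M)) => (max q.1 0, (q.2.2 : M))) (by fun_prop)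
      fun q => ⟨le_max_right q.1 0, q.2.2.2.1.1⟩
  let F : C(ℝ × (E × (basin hXu A \ A : Set M)), E × (basin hXu A \ A : Set M)) :=
    ⟨fun q => (q.2.1, ⟨flow hXu q.2.2 (max q.1 0), hmem q.2 q.1⟩), by fun_prop⟩
  refine ⟨paramMap F τ τ.continuous fun z h => (hτ z).2 (τ z) le_rfl ?_, ?_⟩
  · exact (h.trans (congrArg (flow hXu z.2) (max_eq_left (hτ z).1.le))).symm
  · refine ⟨⟨⟨fun q => F ((1 - (q.1 : ℝ)) * τ q.2, q.2), by fun_prop⟩, fun z => ?_, fun z => ?_⟩⟩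
    · simp [paramMap, subspaceIncl]
    · refine Prod.ext rfl (Subtype.ext ?_)
      simp [F, flow_zero]

/-- The vector field is homotopic, without zeros, to the displacement along short orbits. -/
lemma restrictNonzero_homotopic_displacement (hX : IsC0VectorField X)
    {v : M → M → EuclideanSpace ℝ (Fin n)} {O : Set (M × M)}
    (hvc : ContinuousOn (fun z : M × M => (⟨z.1, v z.1 z.2⟩ : TangentBundle (𝓡 n) M)) O)
    (hv0 : ∀ z ∈ O, v z.1 z.2 = 0 → z.1 = z.2)
    (hv : ∀ p : M, (fun z : M × M => tangentCoordChange (𝓡 n) z.1 p z.1 (v z.1 z.2) -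
        (extChartAt (𝓡 n) p z.2 - extChartAt (𝓡 n) p z.1))
        =o[𝓝 (p, p)] fun z => extChartAt (𝓡 n) p z.2 - extChartAt (𝓡 n) p z.1)
    {E : Set M} (hE : E ⊆ forwardComplete hXu) (h0 : ∀ x ∈ E, X x ≠ 0) (ε : C(E, ℝ))
    (hε : ∀ x, 0 < ε x) (hO : ∀ x : E, ∀ t ∈ Icc 0 (ε x), ((x : M), flow hXu x t) ∈ O)
    (hne : ∀ x : E, ∀ t, 0 < t → flow hXu x t ≠ x) (f : C(E, nonzeroTangent n E))
    (hf : ∀ x : E, (f x : TangentBundle (𝓡 n) M) = ⟨x, v x (flow hXu x (ε x))⟩) :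
    (restrictNonzero X hX E h0).Homotopic f := by
  -- At parameter s this is the difference quotient at time s * ε, starting from X. The positive
  -- factor is 1 at s = 0 and ε at s = 1, where it cancels the division by time.
  refine homotopic_subtype _ _ (fun q : ℝ × E => (⟨q.2, (1 - q.1 + q.1 * (q.1 * ε q.2)) •
    differenceQuotient hXu v (q.1 * ε q.2) q.2⟩ : TangentBundle (𝓡 n) M)) ?_ ?_ ?_ ?_
  · intro q hq
    have hc := continuousOn_differenceQuotient hXu (coordContinuous_of_isC0VectorField hX) hvc hv
    have h1 : ContinuousOn (fun q : ℝ × E => (⟨q.2, differenceQuotient hXu v (q.1 * ε q.2) q.2⟩ :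
        TangentBundle (𝓡 n) M)) (Icc 0 1 ×ˢ univ) := by
      refine hc.comp (f := fun q : ℝ × E => (q.1 * ε q.2, (q.2 : M)))
        (Continuous.continuousOn (by fun_prop)) fun q hq => ?_
      have hq1 : q.1 ∈ Icc (0 : ℝ) 1 := hq.1
      have h2 : 0 ≤ q.1 * ε q.2 := mul_nonneg hq1.1 (hε _).le
      exact ⟨h2, hE q.2.2, hO _ _ ⟨h2, mul_le_of_le_one_left (hε _).le hq1.2⟩⟩
    refine tendsto_tangentBundle_smul (h1 q hq)
      (c := fun q : ℝ × E => 1 - q.1 + q.1 * (q.1 * ε q.2)) ?_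
    exact (Continuous.continuousWithinAt (by fun_prop))
  · intro s hs x
    refine ⟨x.2, ?_⟩
    rcases eq_or_lt_of_le hs.1 with rfl | hs0
    · intro h
      refine h0 x x.2 ?_
      simp only [zero_mul, sub_zero, add_zero, one_smul] at h
      exact (differenceQuotient_zero hXu v x).symm.trans h
    · have h1 : 0 < s * ε x := mul_pos hs0 (hε x)
      have h2 : 0 < 1 - s + s * (s * ε x) := by nlinarith [hs.2, mul_pos hs0 h1]
      intro h
      rw [differenceQuotient_of_ne hXu v h1.ne'] at h
      have h3 := ((smul_eq_zero.1 ((smul_eq_zero.1 h).resolve_left h2.ne')).resolve_left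
        (inv_ne_zero h1.ne'))
      exact hne x _ h1 (hv0 _ (hO x _ ⟨h1.le, mul_le_of_le_one_left (hε _).le hs.2⟩) h3).symm
  · intro x
    simp only [zero_mul, sub_zero, add_zero, one_smul]
    rw [differenceQuotient_zero]
    rfl
  · intro x
    rw [hf]
    simp only [one_mul, sub_self, zero_add]
    rw [differenceQuotient_of_ne hXu v (hε x).ne', smul_smul, mul_inv_cancel₀ (hε x).ne', one_smul]

end Comparison

end VectorFieldFlow

/-! ### Following both flows, and the comparison in homology. -/

namespace VectorFieldFlow

variable {n : ℕ} {M : Type u} [TopologicalSpace M] [ChartedSpace (EuclideanSpace ℝ (Fin n)) M]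
  [IsManifold (𝓡 n) ∞ M] {X Y : ∀ x : M, TangentSpace (𝓡 n) x}

section DoubleFlow

open SingularSubdivision

variable (hXu : UniquelyIntegrable X) (hYu : UniquelyIntegrable Y)

/-- Follow the flow of `X` for time `t⁺`, then the flow of `Y` for time `s⁺`. -/
def doubleFlow (hXu : UniquelyIntegrable X) (hYu : UniquelyIntegrable Y) (s t : ℝ) (x : M) : M :=
  flow hYu (flow hXu x (max t 0)) (max s 0)

lemma doubleFlow_of_nonneg {s t : ℝ} (hs : 0 ≤ s) (ht : 0 ≤ t) (x : M) :
    doubleFlow hXu hYu s t x = flow hYu (flow hXu x t) s := by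
  rw [doubleFlow, max_eq_left hs, max_eq_left ht]

lemma doubleFlow_zero_left {t : ℝ} (ht : 0 ≤ t) (x : M) :
    doubleFlow hXu hYu 0 t x = flow hXu x t := by
  rw [doubleFlow_of_nonneg hXu hYu le_rfl ht, flow_zero]

lemma doubleFlow_zero_right {s : ℝ} (hs : 0 ≤ s) (x : M) :
    doubleFlow hXu hYu s 0 x = flow hYu x s := by
  rw [doubleFlow_of_nonneg hXu hYu hs le_rfl, flow_zero]

variable [T2Space M] {A E : Set M}

lemma continuous_doubleFlow (hX : CoordContinuous X) (hY : CoordContinuous Y)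
    (hEX : E ⊆ basin hXu A) (hEY : ∀ x ∈ E, ∀ t, 0 ≤ t → flow hXu x t ∈ basin hYu A) :
    Continuous fun q : (ℝ × ℝ) × E => doubleFlow hXu hYu q.1.1 q.1.2 q.2 := by
  have h1 : Continuous fun q : (ℝ × ℝ) × E => flow hXu q.2 (max q.1.2 0) :=
    (continuousOn_flow hXu hX).comp_continuous
      (f := fun q : (ℝ × ℝ) × E => (max q.1.2 0, (q.2 : M))) (by fun_prop)
      fun q => ⟨le_max_right q.1.2 0, (hEX q.2.2).1⟩
  exact (continuousOn_flow hYu hY).comp_continuous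
      (f := fun q : (ℝ × ℝ) × E => (max q.1.1 0, flow hXu q.2 (max q.1.2 0))) (by fun_prop)
      fun q => ⟨le_max_right q.1.1 0, (hEY q.2 q.2.2 _ (le_max_right _ _)).1⟩

variable [SecondCountableTopology M] [LocallyCompactSpace M]

/-- Choose a neighbourhood V of A whose Y-orbits stay away from x; after a long time the X-flow has
carried x into V for good. -/
lemma exists_flow_time_no_return (hX : CoordContinuous X) (hXA : IsAsymptoticallyStable X A)
    (hYA : IsAsymptoticallyStable Y A) (hEA : ∀ x ∈ E, x ∉ A) (hEX : E ⊆ basin hXu A) :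
    ∃ T : C(E, ℝ), ∀ x, 0 < T x ∧ ∀ s, 0 ≤ s → flow hYu (flow hXu x (T x)) s ≠ x := by
  let _ : MetricSpace M := TopologicalSpace.metrizableSpaceMetric M
  obtain ⟨T, hT⟩ := exists_continuous_large (S := E)
    (p := fun x a => ∀ t, a ≤ t → ∀ s, 0 ≤ s → flow hYu (flow hXu x t) s ≠ x)
    (fun x a b hab h t ht => h t (hab.trans ht)) (by
      intro x
      obtain ⟨N, hN, W, hW, hAW, hNW⟩ := exists_nhds_disjoint hXA.isCompact.isClosed (hEA x x.2)
      obtain ⟨V, hV, hAV, -, h⟩ := exists_nhds_flow_mem hYu hYA hW hAW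
      obtain ⟨T, -, hT⟩ := eventually_flow_mem hXu hX hXA (hEX x.2) hV hAV
      refine ⟨T, ?_⟩
      have h1 : Tendsto (fun y : E => (y : M)) (𝓝 x) (𝓝[basin hXu A] x) :=
        tendsto_nhdsWithin_iff.2 ⟨continuous_subtype_val.continuousAt,
          Eventually.of_forall fun y => hEX y.2⟩
      filter_upwards [h1.eventually hT, continuous_subtype_val.continuousAt.eventually hN]
        with y hy hyN t ht s hs he
      exact hNW _ hyN (he ▸ (h _ (hy t ht)).2 s hs))
  exact ⟨T, fun x => ⟨(hT x).1, (hT x).2 _ le_rfl⟩⟩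

/-- From every point of the X-orbit the Y-flow eventually stays close to A. The time is chosen
continuously in the X-time as well, so that the latter can be varied. -/
lemma exists_second_time_no_return (hX : CoordContinuous X) (hY : CoordContinuous Y)
    (hYA : IsAsymptoticallyStable Y A) (hEA : ∀ x ∈ E, x ∉ A) (hEX : E ⊆ basin hXu A)
    (hEY : ∀ x ∈ E, ∀ t, 0 ≤ t → flow hXu x t ∈ basin hYu A) :
    ∃ S : C(ℝ × E, ℝ), ∀ q, 0 < S q ∧ doubleFlow hXu hYu (S q) q.1 q.2 ≠ q.2 := by
  let _ : MetricSpace M := TopologicalSpace.metrizableSpaceMetric M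
  obtain ⟨S, hS⟩ := exists_continuous_large (S := ℝ × E)
    (p := fun q a => ∀ s, a ≤ s → flow hYu (flow hXu q.2 (max q.1 0)) s ≠ q.2)
    (fun x a b hab h t ht => h t (hab.trans ht)) (by
      rintro ⟨t, x⟩
      obtain ⟨N, hN, W, hW, hAW, hNW⟩ := exists_nhds_disjoint hYA.isCompact.isClosed (hEA x x.2)
      obtain ⟨S, -, hS⟩ := eventually_flow_mem hYu hY hYA (hEY x x.2 _ (le_max_right t 0)) hW hAW
      refine ⟨S, ?_⟩
      have hc : Continuous fun q : ℝ × E => flow hXu q.2 (max q.1 0) :=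
        (continuousOn_flow hXu hX).comp_continuous
          (f := fun q : ℝ × E => (max q.1 0, (q.2 : M))) (by fun_prop)
          fun q => ⟨le_max_right q.1 0, (hEX q.2.2).1⟩
      have h1 : Tendsto (fun q : ℝ × E => flow hXu q.2 (max q.1 0)) (𝓝 (t, x))
          (𝓝[basin hYu A] (flow hXu x (max t 0))) :=
        tendsto_nhdsWithin_iff.2 ⟨hc.continuousAt (x := (t, x)),
          Eventually.of_forall fun q => hEY _ q.2.2 _ (le_max_right _ _)⟩
      have h2 : ∀ᶠ q : ℝ × E in 𝓝 (t, x), (q.2 : M) ∈ N :=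
        (continuous_subtype_val.comp continuous_snd).continuousAt.eventually hN
      filter_upwards [h1.eventually hS, h2] with q hq hqN s hs he
      exact hNW _ hqN (he ▸ hq s hs))
  refine ⟨S, fun q => ⟨(hS q).1, ?_⟩⟩
  rw [doubleFlow, max_eq_left (hS q).1.le]
  exact (hS q).2 _ le_rfl

lemma convex_comb_pos {a b r : ℝ} (ha : 0 < a) (hb : 0 < b) (hr : r ∈ Icc (0 : ℝ) 1) :
    0 < (1 - r) * a + r * b :=
  convex_Ioi (0 : ℝ) ha hb (sub_nonneg.2 hr.2) hr.1 (by ring)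

/-- The hypotheses keep both flows, and X followed by Y, inside the basins, so that all pairs lie in
E × (basin \ A). There the graph maps of short X- and Y-orbits are compared by
`singularHomologyMap_eq_of_cover` and then sent to tangent vectors by v. -/
theorem singularHomologyMap_restrictNonzero_eq (hX : IsC0VectorField X) (hY : IsC0VectorField Y)
    (hXA : IsAsymptoticallyStable X A) (hYA : IsAsymptoticallyStable Y A)
    (hEA : ∀ x ∈ E, x ∉ A) (hEX : E ⊆ basin hXu A)
    (hEY : ∀ x ∈ E, ∀ t, 0 ≤ t → flow hXu x t ∈ basin hYu A)
    (hEXY : ∀ x ∈ E, ∀ s t, 0 ≤ s → 0 ≤ t → flow hYu (flow hXu x t) s ∈ basin hXu A)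
    (hX0 : ∀ x ∈ E, X x ≠ 0) (hY0 : ∀ x ∈ E, Y x ≠ 0) (G : Type u) [AddCommGroup G] (k : ℕ) :
    singularHomologyMap G k (restrictNonzero X hX E hX0) =
      singularHomologyMap G k (restrictNonzero Y hY E hY0) := by
  let _ : MetricSpace M := TopologicalSpace.metrizableSpaceMetric M
  have hXc := coordContinuous_of_isC0VectorField hX
  have hYc := coordContinuous_of_isC0VectorField hY
  have hEY0 : E ⊆ basin hYu A := fun x hx => by
    have := hEY x hx 0 le_rfl
    rwa [flow_zero] at this
  have hmem : ∀ (q : (ℝ × ℝ) × E), doubleFlow hXu hYu q.1.1 q.1.2 q.2 ∈ basin hXu A \ A := fun q =>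
    ⟨hEXY _ q.2.2 _ _ (le_max_right _ _) (le_max_right _ _),
      flow_notMem hYu hYA.invariant (hEY _ q.2.2 _ (le_max_right _ _)).1
        (flow_notMem hXu hXA.invariant (hEX q.2.2).1 (hEA _ q.2.2) (le_max_right _ _))
        (le_max_right _ _)⟩
  have hcont := continuous_doubleFlow hXu hYu hXc hYc hEX hEY
  let F : C((ℝ × ℝ) × E, E × (basin hXu A \ A : Set M)) :=
    ⟨fun q => (q.2, ⟨doubleFlow hXu hYu q.1.1 q.1.2 q.2, hmem q⟩), by fun_prop⟩
  obtain ⟨v, O', hO', hdiag, hvc, hv0, hv⟩ := exists_displacementVector (n := n) (M := M)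
  let O : Set (E × (basin hXu A \ A : Set M)) := {z | ((z.1 : M), (z.2 : M)) ∈ O'}
  let P : Set (E × (basin hXu A \ A : Set M)) := {z | (z.1 : M) ≠ z.2}
  have hO : IsOpen O := hO'.preimage (by fun_prop)
  have hP : IsOpen P := isOpen_ne_fun (by fun_prop) (by fun_prop)
  have hOP : O ∪ P = univ := by
    refine eq_univ_of_forall fun z => ?_
    by_cases h : (z.1 : M) = z.2
    · left
      change ((z.1 : M), (z.2 : M)) ∈ O'
      rw [← h]
      exact hdiag _
    · exact Or.inr h
  obtain ⟨ε, hε⟩ := exists_continuous_small (S := E)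
    (p := fun x a => ∀ s t, |s| ≤ a → |t| ≤ a → F ((s, t), x) ∈ O)
    (fun x a b hab h s t hs ht => h s t (hs.trans hab) (ht.trans hab)) (by
      intro x
      have h1 : F ⁻¹' O ∈ 𝓝 (((0 : ℝ), (0 : ℝ)), x) := by
        refine (hO.preimage F.continuous).mem_nhds ?_
        change ((x : M), doubleFlow hXu hYu 0 0 x) ∈ O'
        rw [doubleFlow_zero_left hXu hYu le_rfl, flow_zero]
        exact hdiag _
      rw [nhds_prod_eq, mem_prod_iff] at h1
      obtain ⟨U, hU, V, hV, hUV⟩ := h1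
      obtain ⟨a, ha, haU⟩ := Metric.nhds_basis_closedBall.mem_iff.1 hU
      refine ⟨a, ha, ?_⟩
      filter_upwards [hV] with y hy s t hs ht
      refine hUV ⟨haU ?_, hy⟩
      rw [Metric.mem_closedBall, Prod.dist_eq]
      simpa using ⟨hs, ht⟩)
  obtain ⟨T, hT⟩ := exists_flow_time_no_return hXu hYu hXc hXA hYA hEA hEX
  obtain ⟨S, hS⟩ := exists_second_time_no_return hXu hYu hXc hYc hYA hEA hEX hEY
  have hPX : ∀ (x : E) (t : ℝ), 0 < t → F ((0, t), x) ∈ P := fun x t ht => by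
    change (x : M) ≠ doubleFlow hXu hYu 0 t x
    rw [doubleFlow_zero_left hXu hYu ht.le]
    exact (flow_ne_self hXu (hEX x.2) (hEA x x.2) ht).symm
  have hPY : ∀ (x : E) (s : ℝ), 0 < s → F ((s, 0), x) ∈ P := fun x s hs => by
    change (x : M) ≠ doubleFlow hXu hYu s 0 x
    rw [doubleFlow_zero_right hXu hYu hs.le]
    exact (flow_ne_self hYu (hEY0 x.2) (hEA x x.2) hs).symm
  have hPT : ∀ (x : E) (s : ℝ), 0 ≤ s → F ((s, T x), x) ∈ P := fun x s hs => by
    change (x : M) ≠ doubleFlow hXu hYu s (T x) x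
    rw [doubleFlow_of_nonneg hXu hYu hs (hT x).1.le]
    exact ((hT x).2 s hs).symm
  have hPS : ∀ (x : E) (t : ℝ), F ((S (t, x), t), x) ∈ P := fun x t => (hS (t, x)).2.symm
  have hOX : ∀ x : E, F ((0, ε x), x) ∈ O := fun x => (hε x).2 _ _
    (by rw [abs_zero]; exact (hε x).1.le) (abs_of_pos (hε x).1).le
  have hOY : ∀ x : E, F ((ε x, 0), x) ∈ O := fun x => (hε x).2 _ _ (abs_of_pos (hε x).1).le
    (by rw [abs_zero]; exact (hε x).1.le)
  let f : C(E, (O ∩ P : Set _)) := paramMap F (fun x => ((0 : ℝ), ε x)) (by fun_prop)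
    fun x => ⟨hOX x, hPX x _ (hε x).1⟩
  let g : C(E, (O ∩ P : Set _)) := paramMap F (fun x => (ε x, (0 : ℝ))) (by fun_prop)
    fun x => ⟨hOY x, hPY x _ (hε x).1⟩
  have hfgO : ((subspaceInclOfLE (inter_subset_left : O ∩ P ⊆ O)).comp f).Homotopic
      ((subspaceInclOfLE (inter_subset_left : O ∩ P ⊆ O)).comp g) := by
    -- A segment in the plane of flow times from (0, ε) to (ε, 0), with both times at most ε.
    refine homotopic_paramMap F (by fun_prop) (by fun_prop) hOX hOY
      (fun q => (q.1 * ε q.2, (1 - q.1) * ε q.2)) (by fun_prop) (fun x => by simp) (fun x => by simp)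
      fun s hs x => (hε x).2 _ _ ?_ ?_
    · rw [abs_of_nonneg (mul_nonneg hs.1 (hε x).1.le)]
      exact mul_le_of_le_one_left (hε x).1.le hs.2
    · rw [abs_of_nonneg (mul_nonneg (sub_nonneg.2 hs.2) (hε x).1.le)]
      exact mul_le_of_le_one_left (hε x).1.le (sub_le_self _ hs.1)
  have hfgP : ((subspaceInclOfLE (inter_subset_right : O ∩ P ⊆ P)).comp f).Homotopic
      ((subspaceInclOfLE (inter_subset_right : O ∩ P ⊆ P)).comp g) := by
    -- The path of times (Y-time, X-time) is (0, ε) → (0, T) → (S(T), T) → (S(0), 0) → (ε, 0). The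
    -- diagonal is avoided in turn by non-periodicity of X, the choice of T, the choice of S at
    -- every X-time, and non-periodicity of Y.
    have h1 := homotopic_paramMap F (Q := P) (c₀ := fun x => ((0 : ℝ), ε x))
      (c₁ := fun x => ((0 : ℝ), T x)) (by fun_prop) (by fun_prop)
      (fun x => hPX x _ (hε x).1) (fun x => hPX x _ (hT x).1)
      (fun q => (0, (1 - q.1) * ε q.2 + q.1 * T q.2)) (by fun_prop) (fun x => by simp)
      (fun x => by simp) fun s hs x => hPX x _ (convex_comb_pos (hε x).1 (hT x).1 hs)
    have h2 := homotopic_paramMap F (Q := P) (c₀ := fun x => ((0 : ℝ), T x))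
      (c₁ := fun x => (S (T x, x), T x)) (by fun_prop) (by fun_prop)
      (fun x => hPX x _ (hT x).1) (fun x => hPS x _)
      (fun q => (q.1 * S (T q.2, q.2), T q.2)) (by fun_prop) (fun x => by simp)
      (fun x => by simp) fun s hs x => hPT x _ (mul_nonneg hs.1 (hS _).1.le)
    have h3 := homotopic_paramMap F (Q := P) (c₀ := fun x => (S (T x, x), T x))
      (c₁ := fun x => (S (0, x), (0 : ℝ))) (by fun_prop) (by fun_prop)
      (fun x => hPS x _) (fun x => hPS x _)
      (fun q => (S ((1 - q.1) * T q.2, q.2), (1 - q.1) * T q.2)) (by fun_prop) (fun x => by simp)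
      (fun x => by simp) fun s hs x => hPS x _
    have h4 := homotopic_paramMap F (Q := P) (c₀ := fun x => (S (0, x), (0 : ℝ)))
      (c₁ := fun x => (ε x, (0 : ℝ))) (by fun_prop) (by fun_prop)
      (fun x => hPS x _) (fun x => hPY x _ (hε x).1)
      (fun q => ((1 - q.1) * S (0, q.2) + q.1 * ε q.2, 0)) (by fun_prop) (fun x => by simp)
      (fun x => by simp) fun s hs x => hPY x _ (convex_comb_pos (hS _).1 (hε x).1 hs)
    exact ((h1.trans h2).trans h3).trans h4
  obtain ⟨r, hr⟩ := exists_deformation_offDiagonal hXu hXc hXA hEA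
  have hfg := singularHomologyMap_eq_of_cover hO hP hOP r hr f g hfgO hfgP G k
  -- Membership in O makes v continuous, and membership in P makes it nonzero.
  let θ : C((O ∩ P : Set _), nonzeroTangent n E) :=
    ⟨fun z => ⟨⟨z.1.1, v z.1.1 z.1.2⟩, z.1.1.2, fun h => z.2.2 (hv0 (_, _) z.2.1 h)⟩,
      Continuous.subtype_mk (hvc.comp_continuous
        (f := fun z : (O ∩ P : Set _) => ((z.1.1 : M), (z.1.2 : M))) (by fun_prop)
        fun z => z.2.1) _⟩
  have hθf : (restrictNonzero X hX E hX0).Homotopic (θ.comp f) := by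
    refine restrictNonzero_homotopic_displacement hXu hX hvc hv0 hv (fun x hx => (hEX hx).1) hX0 ε
      (fun x => (hε x).1) (fun x t ht => ?_)
      (fun x t ht => flow_ne_self hXu (hEX x.2) (hEA x x.2) ht) _ fun x => ?_
    · have h := (hε x).2 0 t (by rw [abs_zero]; exact (hε x).1.le)
        (by rw [abs_of_nonneg ht.1]; exact ht.2)
      rw [← doubleFlow_zero_left hXu hYu ht.1]
      exact h
    · exact congrArg (fun y => (⟨x, v x y⟩ : TangentBundle (𝓡 n) M))
        (doubleFlow_zero_left hXu hYu (hε x).1.le x)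
  have hθg : (restrictNonzero Y hY E hY0).Homotopic (θ.comp g) := by
    refine restrictNonzero_homotopic_displacement hYu hY hvc hv0 hv (fun x hx => (hEY0 hx).1) hY0 ε
      (fun x => (hε x).1) (fun x s hs => ?_)
      (fun x t ht => flow_ne_self hYu (hEY0 x.2) (hEA x x.2) ht) _ fun x => ?_
    · have h := (hε x).2 s 0 (by rw [abs_of_nonneg hs.1]; exact hs.2)
        (by rw [abs_zero]; exact (hε x).1.le)
      rw [← doubleFlow_zero_right hXu hYu hs.1]
      exact h
    · exact congrArg (fun y => (⟨x, v x y⟩ : TangentBundle (𝓡 n) M))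
        (doubleFlow_zero_right hXu hYu (hε x).1.le x)
  rw [singularHomologyMap_congr G k hθf, singularHomologyMap_congr G k hθg,
    singularHomologyMap_comp, singularHomologyMap_comp, hfg]

end DoubleFlow

end VectorFieldFlow
end

theorem mainTheorem2 {n : ℕ} {M : Type u} [TopologicalSpace M] [T2Space M]
    [SecondCountableTopology M] [ChartedSpace (EuclideanSpace ℝ (Fin n)) M]
    [IsManifold (𝓡 n) ∞ M]
    (X Y : ∀ x : M, TangentSpace (𝓡 n) x)
    (hX : IsC0VectorField X) (hY : IsC0VectorField Y)
    (hXu : UniquelyIntegrable X) (hYu : UniquelyIntegrable Y)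
    (A : Set M) (hXA : IsAsymptoticallyStable X A) (hYA : IsAsymptoticallyStable Y A) :
    ∃ U₀ : Set M, IsOpen U₀ ∧ A ⊆ U₀ ∧
      ∀ U : Set M, IsOpen U → A ⊆ U → U ⊆ U₀ →
        ∃ (hX0 : ∀ x ∈ U \ A, X x ≠ 0) (hY0 : ∀ x ∈ U \ A, Y x ≠ 0),
          ∀ (G : Type u) [AddCommGroup G] (k : ℕ),
            singularHomologyMap G k (restrictNonzero X hX (U \ A) hX0) =
              singularHomologyMap G k (restrictNonzero Y hY (U \ A) hY0) := by
  have : LocallyCompactSpace M := ChartedSpace.locallyCompactSpace (EuclideanSpace ℝ (Fin n)) M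
  -- Nested neighbourhoods: X-orbits from V₂ stay in V₁, Y-orbits from V₁ stay in V₀, and V₀ lies in
  -- the basin of X. Thus X followed by Y never leaves the basin of X.
  obtain ⟨V₀, hV₀, hAV₀, -, h₀⟩ := VectorFieldFlow.exists_nhds_flow_mem hXu hXA isOpen_univ (subset_univ A)
  obtain ⟨V₁, hV₁, hAV₁, -, h₁⟩ := VectorFieldFlow.exists_nhds_flow_mem hYu hYA hV₀ hAV₀
  obtain ⟨V₂, hV₂, hAV₂, hV₂₁, h₂⟩ := VectorFieldFlow.exists_nhds_flow_mem hXu hXA hV₁ hAV₁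
  refine ⟨V₂, hV₂, hAV₂, fun U _ _ hU => ⟨fun x hx =>
    VectorFieldFlow.ne_zero_of_mem_basin hXu (h₂ x (hU hx.1)).1 hx.2, fun x hx =>
    VectorFieldFlow.ne_zero_of_mem_basin hYu (h₁ x (hV₂₁ (hU hx.1))).1 hx.2, fun G _ k => ?_⟩⟩
  exact VectorFieldFlow.singularHomologyMap_restrictNonzero_eq hXu hYu hX hY hXA hYA (fun x hx => hx.2)
    (fun x hx => (h₂ x (hU hx.1)).1)
    (fun x hx t ht => (h₁ _ ((h₂ x (hU hx.1)).2 t ht)).1)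
    (fun x hx s t hs ht => (h₀ _ ((h₁ _ ((h₂ x (hU hx.1)).2 t ht)).2 s hs)).1) _ _ G k
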